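/- Let $n\ge 1$ be an integer, $\alpha>0$ and $K\ge 1$ real numbers, $\lambda\in(0,1]$, and let $\mathbb B^n$ be the open Euclidean unit ball of $\mathbb C^n$. Let $f:\mathbb B^n\to\mathbb C^n$ be holomorphic with complex Jacobian matrix $f'$, write $|f'(z)|$ for the operator norm of $f'(z)$ with respect to the Euclidean norm, and put $$\|f\|_\alpha=\sup_{z\in\mathbb B^n}(1-|z|^2)^\alpha|f'(z)|,\qquad \|f\|_{0,\alpha}=\sup_{z\in\mathbb B^n}(1-|z|^2)^{\frac{\alpha(n+1)}{2n}}|\det f'(z)|^{\frac1n}.$$ Suppose that $f$ belongs to the $\alpha$-Bloch space, i.e. $\|f\|_\alpha+|f(0)|<\infty$, and that $\|f\|_\alpha\le K$, $\|f\|_{0,\alpha}=1$ and $\det f'(0)=\lambda$. Let $a_0=\frac{1}{\sqrt{\alpha(n+1)+1}}$ and $$\varphi(x)=x(1-x^2)^{\frac{\alpha(n+1)}2}\sqrt{\alpha(n+1)+1}\left[\frac{\alpha(n+1)+1}{\alpha(n+1)}\right]^{\frac{\alpha(n+1)}2}\qquad(0\le x\le 1).$$ A schlicht ball of $f$ centred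 at $f(0)$ is an open ball of positive radius with centre $f(0)$ onto which $f$ maps biholomorphically some open subset of $\mathbb B^n$ containing $0$. Then the equation $\varphi(x)=\lambda$ has exactly one root $m(\lambda)$ in $[0,a_0]$, there is a largest schlicht ball of $f$ centred at $f(0)$, and its radius $r(0,f)$ satisfies $$r(0,f)\ \ge\ \frac{\lambda K^{1-n}}{m(\lambda)}\int_0^{m(\lambda)}\frac{(1-t^2)^{\alpha(n-1)}\,(m(\lambda)-t)}{(1-m(\lambda)t)^{\alpha(n+1)+1}}\,dt .$$ -/

import Mathlib

open Set Metric

open scoped ENNReal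

noncomputable section

/-- Complex Euclidean space `ℂⁿ` with `|z| = (∑ |z_k|²)^{1/2}`. -/
abbrev CSpace (n : ℕ) : Type := EuclideanSpace ℂ (Fin n)

/-- The open unit ball of `ℂⁿ`. -/
abbrev unitBall (n : ℕ) : Set (CSpace n) := ball 0 1

/-- The class `H(𝔹ⁿ)` of holomorphic maps from the unit ball of `ℂⁿ` to `ℂⁿ`
(the values of `f` outside the ball are irrelevant). -/
def HolomorphicOnBall {n : ℕ} (f : CSpace n → CSpace n) : Prop :=
  DifferentiableOn ℂ f (unitBall n)

/-- The `α`-Bloch semi-norm `sup_{z ∈ 𝔹ⁿ} (1 - |z|²)^α |f'(z)|`, valued in `[0, ∞]`; here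
`|f'(z)|` is the operator norm of the complex derivative for the Euclidean norm. -/
def blochSeminorm {n : ℕ} (α : ℝ) (f : CSpace n → CSpace n) : ℝ≥0∞ :=
  ⨆ z ∈ unitBall n, ENNReal.ofReal ((1 - ‖z‖ ^ 2) ^ α * ‖fderiv ℂ f z‖)

/-- Membership in the `α`-Bloch space. -/
def MemBloch {n : ℕ} (α : ℝ) (f : CSpace n → CSpace n) : Prop :=
  HolomorphicOnBall f ∧ blochSeminorm α f + ‖f 0‖ₑ < ⊤

/-- The semi-norm `‖f‖_{0,α} = sup_{z ∈ 𝔹ⁿ} (1 - |z|²)^{α(n+1)/(2n)} |det f'(z)|^{1/n}`,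
valued in `[0, ∞]`. -/
def detSeminorm {n : ℕ} (α : ℝ) (f : CSpace n → CSpace n) : ℝ≥0∞ :=
  ⨆ z ∈ unitBall n, ENNReal.ofReal
    ((1 - ‖z‖ ^ 2) ^ (α * ((n : ℝ) + 1) / (2 * (n : ℝ))) *
      ‖(fderiv ℂ f z).det‖ ^ (1 / (n : ℝ)))

/-- `f` maps `U` biholomorphically onto `V` (used for open `U`, `V`). -/
def MapsBiholomorphically {n : ℕ} (f : CSpace n → CSpace n) (U V : Set (CSpace n)) : Prop :=
  DifferentiableOn ℂ f U ∧ MapsTo f U V ∧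
    ∃ g : CSpace n → CSpace n, DifferentiableOn ℂ g V ∧ MapsTo g V U ∧ InvOn g f U V

/-- The ball of centre `f w` and radius `r > 0` is a schlicht ball of `f`: `f` maps an open
subset of the unit ball containing `w` biholomorphically onto it. -/
def IsSchlichtBall {n : ℕ} (f : CSpace n → CSpace n) (w : CSpace n) (r : ℝ) : Prop :=
  0 < r ∧ ∃ U : Set (CSpace n), IsOpen U ∧ U ⊆ unitBall n ∧ w ∈ U ∧
    MapsBiholomorphically f U (ball (f w) r)

/-- `r(w, f)`, the radius of the largest schlicht ball of `f` centred at `f w`. -/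
def schlichtRadius {n : ℕ} (w : CSpace n) (f : CSpace n → CSpace n) : ℝ :=
  sSup {r : ℝ | IsSchlichtBall f w r}

/-- `φ(x) = x (1 - x²)^{α(n+1)/2} √(α(n+1)+1) [(α(n+1)+1) / (α(n+1))]^{α(n+1)/2}`. -/
def blochPhi (n : ℕ) (α x : ℝ) : ℝ :=
  x * (1 - x ^ 2) ^ (α * ((n : ℝ) + 1) / 2) * Real.sqrt (α * (1 + (n : ℝ)) + 1) *
    ((α * ((n : ℝ) + 1) + 1) / (α * ((n : ℝ) + 1))) ^ (α * ((n : ℝ) + 1) / 2)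

/-- `a₀ = 1 / √(α(n+1)+1)`. -/
def blochA0 (n : ℕ) (α : ℝ) : ℝ := 1 / Real.sqrt (α * (1 + (n : ℝ)) + 1)

/-- `x = m(lam)`: `x` is a root of `φ(x) = lam` in the interval `[0, a₀]`. -/
def IsBlochRoot (n : ℕ) (α lam x : ℝ) : Prop :=
  x ∈ Icc 0 (blochA0 n α) ∧ blochPhi n α x = lam

end

/-!
# Schlicht balls of `α`-Bloch mappings

Write `β = α (n + 1)`, `a₀ = (β + 1) ^ (-1/2)` and `κ = (1 - a₀²) ^ (β / 2)`, so that
`φ x = x (1 - x²) ^ (β / 2) / (a₀ κ)` is the weighted modulus of the function `ζ ↦ ζ / (a₀ κ)` on the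
disc. It increases strictly from `0` to `1` on `[0, a₀]`, whence the root `m`.

The heart of the matter is the sharp bound
`|det f' z| ≥ (lam / m) (m - |z|) / (1 - m |z|) ^ (β + 1)` for `|z| < m` (`le_norm_det_fderiv`). Restrict
`det f'` to the complex line through `z` to get `g` on the disc, with
`(1 - |ζ|²) ^ (β / 2) |g ζ| ≤ 1` and `|g 0| = φ m`. Pull `g` back by the disc automorphism that
exchanges `0` and `m`, with the weight that preserves this inequality: the new function is bounded by
`κ⁻¹` on the disc of radius `a₀` and has modulus `m / (a₀ κ)` at `m`. After rescaling it is a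
self-map of the unit disc that preserves the modulus of the point `m / a₀`, and the
Schwarz–Pick lemma says that it cannot bring the points between `0` and `m / a₀` closer to the origin.
Undoing the change of variable gives the bound if `m < a₀`; the case `m = a₀` follows by a limit
(`distortion_of_le`).

Hadamard's inequality gives `|det A| |v| ≤ |A|ⁿ⁻¹ |A v|` (`norm_det_mul_norm_le`), so the bounds for
`det f'` and for `|f'|` show that `f` expands lengths at `z` by at least `h |z|`, where `h` is the
integrand of the theorem with its constant factor.

Schlicht balls of different radii have nested domains, so the union of these domains gives a largest
one, of radius `r`, say. If `r` were less than `∫₀ᵐ h`, then `r = ∫₀^ρ h` with `ρ < m`, and comparing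
lengths along the preimages of the radii shows that the domain lies in the closed ball of radius `ρ`
(`IsSchlichtDomain.subset_closedBall`). There the Jacobian does not vanish and `f` expands uniformly,
so `f` is injective on the compact closure of the domain, hence near it, and there is a larger schlicht
ball (`IsSchlichtDomain.exists_radius_gt`), a contradiction.
-/

open Filter Topology

/-! ### Regularity of holomorphic maps in several variables -/

section Holomorphic

variable {E F : Type*} [NormedAddCommGroup E] [NormedSpace ℂ E]
  [NormedAddCommGroup F] [NormedSpace ℂ F]

/-- Holomorphic maps on a finite-dimensional space are continuously differentiable: by the
Schwarz lemma the derivative of `y ↦ f (y + h) - f y` at `x` is controlled by its oscillation near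
`x`, which is small for small `h` by uniform continuity. -/
theorem continuousAt_fderiv_of_differentiableOn [ProperSpace E] {f : E → F} {s : Set E} {x : E}
    (hf : DifferentiableOn ℂ f s) (hs : s ∈ 𝓝 x) : ContinuousAt (fderiv ℂ f) x := by
  obtain ⟨r, hr, hrs⟩ := Metric.nhds_basis_closedBall.mem_iff.1 hs
  have hfi : DifferentiableOn ℂ f (ball x r) := hf.mono (ball_subset_closedBall.trans hrs)
  have huc : UniformContinuousOn f (closedBall x r) :=
    (isCompact_closedBall x r).uniformContinuousOn_of_continuous (hf.mono hrs).continuousOn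
  rw [Metric.continuousAt_iff]
  intro ε hε
  obtain ⟨η, hη, hfη⟩ := Metric.uniformContinuousOn_iff.1 huc (ε * (r / 2) / 4) (by positivity)
  refine ⟨min η (r / 2), by positivity, fun {y} hy => ?_⟩
  rw [lt_min_iff] at hy
  set h := y - x with hh
  have hnh : ‖h‖ = dist y x := by rw [dist_eq_norm]
  have hmem : ∀ z ∈ ball x (r / 2), z ∈ ball x r ∧ z + h ∈ ball x r := by
    intro z hz
    rw [mem_ball] at hz
    refine ⟨mem_ball.2 (by linarith), mem_ball.2 ?_⟩
    calc dist (z + h) x ≤ dist (z + h) z + dist z x := dist_triangle _ _ _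
      _ < r := by rw [dist_self_add_left, hnh]; linarith
  have hd : DifferentiableOn ℂ (fun z => f (z + h) - f z) (ball x (r / 2)) := by
    refine DifferentiableOn.sub ?_ (hfi.mono fun z hz => (hmem z hz).1)
    exact hfi.comp (by fun_prop) fun z hz => (hmem z hz).2
  have hsmall : ∀ z ∈ ball x (r / 2), ‖f (z + h) - f z‖ < ε * (r / 2) / 4 := by
    intro z hz
    rw [← dist_eq_norm]
    refine hfη _ (ball_subset_closedBall (hmem z hz).2) _ (ball_subset_closedBall (hmem z hz).1) ?_
    rw [dist_self_add_left, hnh]; exact hy.1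
  have hx0 : x ∈ ball x (r / 2) := mem_ball_self (by positivity)
  have hmaps : MapsTo (fun z => f (z + h) - f z) (ball x (r / 2))
      (closedBall (f (x + h) - f x) (ε * (r / 2) / 2)) := by
    intro z hz
    rw [mem_closedBall, dist_eq_norm]
    refine (norm_sub_le _ _).trans ?_
    linarith [hsmall z hz, hsmall x hx0]
  have hle := Complex.norm_fderiv_le_div_of_mapsTo_ball hd hmaps (by positivity)
  have hda : ∀ z ∈ ball x r, DifferentiableAt ℂ f z := fun z hz =>
    (hfi z hz).differentiableAt (isOpen_ball.mem_nhds hz)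
  have hD : fderiv ℂ (fun z => f (z + h) - f z) x = fderiv ℂ f y - fderiv ℂ f x := by
    have hxy : x + h = y := by rw [hh]; abel
    rw [fderiv_fun_sub _ (hda x (hmem x hx0).1), fderiv_comp_add_right, hxy]
    exact (hda _ (hmem x hx0).2).comp x (by fun_prop)
  rw [hD] at hle
  rw [dist_eq_norm]
  have : ε * (r / 2) / 2 / (r / 2) = ε / 2 := by field_simp
  linarith

theorem hasStrictFDerivAt_of_differentiableOn [ProperSpace E] {f : E → F} {s : Set E} {x : E}
    (hf : DifferentiableOn ℂ f s) (hs : s ∈ 𝓝 x) : HasStrictFDerivAt f (fderiv ℂ f x) x :=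
  hasStrictFDerivAt_of_hasFDerivAt_of_continuousAt
    ((eventually_mem_nhds_iff.2 hs).mono fun _ hy => (hf.differentiableAt hy).hasFDerivAt)
    (continuousAt_fderiv_of_differentiableOn hf hs)

/-- The directional derivatives of a holomorphic map are holomorphic along complex lines, being
locally uniform limits of difference quotients. -/
theorem differentiableOn_fderiv_line [ProperSpace E] [CompleteSpace F] {f : E → F} {s : Set E}
    (hs : IsOpen s) (hf : DifferentiableOn ℂ f s) (u v : E) :
    DifferentiableOn ℂ (fun ζ : ℂ => fderiv ℂ f (ζ • u) v) {ζ | ζ • u ∈ s} := by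
  have hopen : IsOpen {ζ : ℂ | ζ • u ∈ s} := hs.preimage (by fun_prop)
  refine differentiableOn_of_locally_differentiableOn fun ζ₀ hζ₀ => ?_
  -- a neighbourhood on which all small difference quotients are defined
  obtain ⟨r, hr, hrs⟩ := Metric.isOpen_iff.1 hs _ hζ₀
  set U : Set ℂ := {ζ | ζ • u ∈ ball (ζ₀ • u) (r / 2)} with hU
  have hUo : IsOpen U := isOpen_ball.preimage (by fun_prop)
  have hUs : U ⊆ {ζ | ζ • u ∈ s} := fun ζ hζ => hrs (ball_subset_ball (by linarith) hζ)
  refine ⟨U, hUo, mem_ball_self (by positivity), ?_⟩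
  rw [inter_eq_right.2 hUs]
  have hlim : TendstoLocallyUniformlyOn
      (fun (t : ℂ) (ζ : ℂ) => t⁻¹ • (f (ζ • u + t • v) - f (ζ • u)))
      (fun ζ => fderiv ℂ f (ζ • u) v) (𝓝[≠] 0) U := by
    rw [Metric.tendstoLocallyUniformlyOn_iff]
    intro ε hε ζ hζ
    have hnhds : s ∈ 𝓝 (ζ • u) := hs.mem_nhds (hUs hζ)
    have hstrict := hasStrictFDerivAt_of_differentiableOn hf hnhds
    rw [hasStrictFDerivAt_iff_isLittleO, Asymptotics.isLittleO_iff] at hstrict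
    have hc := hstrict (c := ε / 2 / (‖v‖ + 1)) (by positivity)
    have htend : Tendsto (fun p : ℂ × ℂ => (p.1 • u + p.2 • v, p.1 • u)) (𝓝 (ζ, 0))
        (𝓝 (ζ • u, ζ • u)) := by
      have : Continuous (fun p : ℂ × ℂ => (p.1 • u + p.2 • v, p.1 • u)) := by fun_prop
      simpa using this.tendsto (ζ, 0)
    have h1 := htend.eventually hc
    have h2 : ∀ᶠ z : ℂ in 𝓝 ζ,
        ‖fderiv ℂ f (z • u) v - fderiv ℂ f (ζ • u) v‖ < ε / 2 := by
      have hcont : ContinuousAt (fun z : ℂ => fderiv ℂ f (z • u) v) ζ := by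
        have := (continuousAt_fderiv_of_differentiableOn hf hnhds).comp
          (f := fun z : ℂ => z • u) (x := ζ) (by fun_prop)
        exact this.clm_apply continuousAt_const
      simpa [dist_eq_norm] using Metric.tendsto_nhds.1 hcont (ε / 2) (by positivity)
    rw [nhds_prod_eq, eventually_prod_iff] at h1
    obtain ⟨pa, hpa, pb, hpb, hab⟩ := h1
    refine ⟨_, mem_nhdsWithin_of_mem_nhds (hpa.and h2), ?_⟩
    filter_upwards [nhdsWithin_le_nhds hpb, self_mem_nhdsWithin] with t ht ht0 z hz
    have ht0' : t ≠ 0 := ht0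
    have h3 := hab hz.1 ht
    simp only [add_sub_cancel_left, map_smul, norm_smul] at h3
    have h4 : ‖fderiv ℂ f (ζ • u) v - t⁻¹ • (f (z • u + t • v) - f (z • u))‖ ≤ ε / 2 := by
      have : fderiv ℂ f (ζ • u) v - t⁻¹ • (f (z • u + t • v) - f (z • u))
          = - (t⁻¹ • (f (z • u + t • v) - f (z • u) - t • fderiv ℂ f (ζ • u) v)) := by
        rw [smul_sub t⁻¹ (f _ - f _), smul_smul, inv_mul_cancel₀ ht0', one_smul]; abel
      rw [this, norm_neg, norm_smul, norm_inv, inv_mul_le_iff₀ (norm_pos_iff.2 ht0')]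
      refine h3.trans ?_
      have : ‖v‖ / (‖v‖ + 1) ≤ 1 := by rw [div_le_one (by positivity)]; linarith
      calc ε / 2 / (‖v‖ + 1) * (‖t‖ * ‖v‖) = ‖t‖ * (ε / 2) * (‖v‖ / (‖v‖ + 1)) := by ring
        _ ≤ ‖t‖ * (ε / 2) * 1 := by gcongr
        _ = _ := by ring
    rw [dist_eq_norm]
    calc _ = ‖(fderiv ℂ f (z • u) v - fderiv ℂ f (ζ • u) v) +
          (fderiv ℂ f (ζ • u) v - t⁻¹ • (f (z • u + t • v) - f (z • u)))‖ := by
            congr 1; abel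
      _ ≤ _ := norm_add_le _ _
      _ < ε := by linarith [hz.2]
  refine hlim.differentiableOn ?_ hUo
  have hsmall : ∀ᶠ t : ℂ in 𝓝 0, ‖t • v‖ < r / 2 := by
    have : Tendsto (fun t : ℂ => ‖t • v‖) (𝓝 0) (𝓝 ‖(0 : ℂ) • v‖) :=
      (by fun_prop : Continuous fun t : ℂ => ‖t • v‖).tendsto 0
    refine this.eventually (gt_mem_nhds ?_)
    simpa using hr
  filter_upwards [nhdsWithin_le_nhds hsmall] with t ht
  refine DifferentiableOn.const_smul (DifferentiableOn.sub ?_ ?_) _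
  · refine hf.comp (by fun_prop) fun ζ hζ => hrs ?_
    have hζ' : dist (ζ • u) (ζ₀ • u) < r / 2 := hζ
    rw [mem_ball]
    calc dist (ζ • u + t • v) (ζ₀ • u) ≤ dist (ζ • u + t • v) (ζ • u) + dist (ζ • u) (ζ₀ • u) :=
          dist_triangle _ _ _
      _ < r := by rw [dist_self_add_left]; linarith
  · exact hf.comp (by fun_prop) hUs

end Holomorphic

/-- The Jacobian determinant of a holomorphic map is holomorphic along complex lines through the
origin. -/
theorem differentiableOn_det_fderiv_line {n : ℕ} {f : CSpace n → CSpace n} {s : Set (CSpace n)}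
    (hs : IsOpen s) (hf : DifferentiableOn ℂ f s) (u : CSpace n) :
    DifferentiableOn ℂ (fun ζ : ℂ => (fderiv ℂ f (ζ • u)).det) {ζ | ζ • u ∈ s} := by
  let b := (EuclideanSpace.basisFun (Fin n) ℂ).toBasis
  have hdet : ∀ A : CSpace n →L[ℂ] CSpace n, A.det =
      ∑ σ : Equiv.Perm (Fin n), (Equiv.Perm.sign σ : ℂ) * ∏ i, (A (b i)) (σ i) := by
    intro A
    rw [ContinuousLinearMap.det, ← LinearMap.det_toMatrix b, Matrix.det_apply']
    simp [b, LinearMap.toMatrix_apply]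
  simp only [hdet]
  refine DifferentiableOn.fun_sum fun σ _ => DifferentiableOn.const_mul ?_ _
  refine DifferentiableOn.fun_finsetProd fun i _ => ?_
  have := differentiableOn_fderiv_line hs hf u (b i)
  exact (EuclideanSpace.proj (σ i) : CSpace n →L[ℂ] ℂ).differentiable.comp_differentiableOn this

/-! ### Determinants and expansion of lengths -/

section Determinant

variable {E : Type*} [NormedAddCommGroup E] [InnerProductSpace ℂ E]

/-- Hadamard's inequality, for an endomorphism and an orthonormal basis. -/
theorem norm_det_le_prod_norm {n : ℕ} (b : OrthonormalBasis (Fin n) ℂ E) (A : E →ₗ[ℂ] E) :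
    ‖LinearMap.det A‖ ≤ ∏ i, ‖A (b i)‖ := by
  have : FiniteDimensional ℂ E := b.toBasis.finiteDimensional_of_finite
  have hdim : Module.finrank ℂ E = Fintype.card (Fin n) := Module.finrank_eq_card_basis b.toBasis
  let e := InnerProductSpace.gramSchmidtOrthonormalBasis hdim (A ∘ b)
  have h1 : ‖e.toBasis.det (A ∘ b)‖ = ‖LinearMap.det A‖ := by
    rw [Module.Basis.det_comp, norm_mul, e.det_to_matrix_orthonormalBasis b, mul_one]
  rw [← h1, InnerProductSpace.gramSchmidtOrthonormalBasis_det, norm_prod]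
  refine Finset.prod_le_prod (fun _ _ => norm_nonneg _) fun i _ => ?_
  refine (norm_inner_le_norm _ _).trans ?_
  rw [OrthonormalBasis.norm_eq_one, one_mul]
  rfl

/-- An endomorphism of `ℂⁿ` expands every vector by at least `|det A| / ‖A‖ⁿ⁻¹`: apply
Hadamard's inequality to an orthonormal basis starting with the direction of `v`. -/
theorem norm_det_mul_norm_le {n : ℕ} (hn : 1 ≤ n) (A : CSpace n →L[ℂ] CSpace n) (v : CSpace n) :
    ‖A.det‖ * ‖v‖ ≤ ‖A‖ ^ (n - 1) * ‖A v‖ := by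
  rcases eq_or_ne v 0 with rfl | hv
  · simp
  have hv' : ‖v‖ ≠ 0 := norm_ne_zero_iff.2 hv
  let i₀ : Fin n := ⟨0, hn⟩
  have hon : Orthonormal ℂ (({i₀} : Set (Fin n)).domRestrict
      fun _ => ((‖v‖⁻¹ : ℝ) : ℂ) • v) := by
    refine ⟨fun i => ?_, fun i j hij => absurd (Subsingleton.elim i j) hij⟩
    simp [norm_smul, hv']
  obtain ⟨b, hb⟩ := hon.exists_orthonormalBasis_extension_of_card_eq (by simp)
  have hb0 : b i₀ = ((‖v‖⁻¹ : ℝ) : ℂ) • v := hb i₀ rfl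
  have hAb : ‖A (b i₀)‖ = ‖v‖⁻¹ * ‖A v‖ := by
    rw [hb0, map_smul, norm_smul]; simp
  have hprod : ∏ i ∈ Finset.univ.erase i₀, ‖A (b i)‖ ≤ ‖A‖ ^ (n - 1) := by
    calc ∏ i ∈ Finset.univ.erase i₀, ‖A (b i)‖ ≤ ∏ _i ∈ Finset.univ.erase i₀, ‖A‖ :=
          Finset.prod_le_prod (fun _ _ => norm_nonneg _) fun i _ =>
            (A.le_opNorm _).trans (by rw [b.norm_eq_one, mul_one])
      _ = ‖A‖ ^ (n - 1) := by simp [Finset.card_erase_of_mem]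
  have hH : ‖A.det‖ ≤ ∏ i, ‖A (b i)‖ := norm_det_le_prod_norm b (A : CSpace n →ₗ[ℂ] CSpace n)
  rw [← Finset.mul_prod_erase _ _ (Finset.mem_univ i₀), hAb] at hH
  calc ‖A.det‖ * ‖v‖ ≤ (‖v‖⁻¹ * ‖A v‖ * ‖A‖ ^ (n - 1)) * ‖v‖ := by gcongr; exact hH.trans (by gcongr)
    _ = _ := by field_simp

end Determinant

/-! ### Sharp lower bounds on the unit disc -/

section Distortion

theorem sq_norm_one_sub_conj_mul_sub (a y : ℂ) :
    ‖1 - (starRingEnd ℂ) a * y‖ ^ 2 - ‖y - a‖ ^ 2 = (1 - ‖a‖ ^ 2) * (1 - ‖y‖ ^ 2) := by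
  simp only [Complex.sq_norm, Complex.normSq_apply, Complex.sub_re, Complex.sub_im, Complex.mul_re,
    Complex.mul_im, Complex.conj_re, Complex.conj_im, Complex.one_re, Complex.one_im]
  ring

/-- The involutive automorphism of the unit disc that exchanges `0` and the real point `m`. -/
noncomputable def discInvolution (m : ℝ) (w : ℂ) : ℂ := (m - w) / (1 - m * w)

theorem one_sub_ofReal_mul_ne_zero {m : ℝ} (hm0 : 0 ≤ m) (hm1 : m < 1) {w : ℂ} (hw : ‖w‖ < 1) :
    1 - (m : ℂ) * w ≠ 0 := by
  intro h
  have h1 : (m : ℂ) * w = 1 := (sub_eq_zero.1 h).symm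
  have h2 : m * ‖w‖ = 1 := by
    have := congrArg norm h1
    simpa [abs_of_nonneg hm0] using this
  nlinarith [norm_nonneg w]

theorem re_one_sub_ofReal_mul_pos {m : ℝ} (hm0 : 0 ≤ m) (hm1 : m < 1) {w : ℂ} (hw : ‖w‖ < 1) :
    0 < (1 - (m : ℂ) * w).re := by
  have : w.re ≤ ‖w‖ := Complex.re_le_norm w
  simp only [Complex.sub_re, Complex.one_re, Complex.mul_re, Complex.ofReal_re, Complex.ofReal_im,
    zero_mul, sub_zero]
  nlinarith [norm_nonneg w]

theorem one_sub_sq_norm_discInvolution {m : ℝ} (hm0 : 0 ≤ m) (hm1 : m < 1) {w : ℂ}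
    (hw : ‖w‖ < 1) : 1 - ‖discInvolution m w‖ ^ 2 =
      (1 - ‖w‖ ^ 2) * (1 - m ^ 2) / ‖1 - (m : ℂ) * w‖ ^ 2 := by
  have hne : ‖1 - (m : ℂ) * w‖ ≠ 0 := norm_ne_zero_iff.2 (one_sub_ofReal_mul_ne_zero hm0 hm1 hw)
  have h := sq_norm_one_sub_conj_mul_sub (m : ℂ) w
  rw [Complex.conj_ofReal, Complex.norm_real, Real.norm_eq_abs, sq_abs] at h
  rw [discInvolution, norm_div, div_pow, norm_sub_rev (m : ℂ) w]
  rw [eq_div_iff (pow_ne_zero 2 hne), sub_mul, div_mul_cancel₀ _ (pow_ne_zero 2 hne)]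
  linarith

theorem norm_discInvolution_lt_one {m : ℝ} (hm0 : 0 ≤ m) (hm1 : m < 1) {w : ℂ} (hw : ‖w‖ < 1) :
    ‖discInvolution m w‖ < 1 := by
  have hne : 0 < ‖1 - (m : ℂ) * w‖ := norm_pos_iff.2 (one_sub_ofReal_mul_ne_zero hm0 hm1 hw)
  have h := one_sub_sq_norm_discInvolution hm0 hm1 hw
  have h1 : 0 < 1 - ‖w‖ ^ 2 := by nlinarith [norm_nonneg w]
  have h2 : 0 < 1 - m ^ 2 := by nlinarith
  have : 0 < (1 - ‖w‖ ^ 2) * (1 - m ^ 2) / ‖1 - (m : ℂ) * w‖ ^ 2 := by positivity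
  nlinarith [norm_nonneg (discInvolution m w)]

theorem differentiableOn_discInvolution {m : ℝ} (hm0 : 0 ≤ m) (hm1 : m < 1) :
    DifferentiableOn ℂ (discInvolution m) (ball 0 1) := by
  refine DifferentiableOn.div (by fun_prop) (by fun_prop) fun w hw => ?_
  exact one_sub_ofReal_mul_ne_zero hm0 hm1 (by simpa using hw)

theorem discInvolution_discInvolution {m : ℝ} (hm0 : 0 ≤ m) (hm1 : m < 1) {w : ℂ}
    (hw : ‖w‖ < 1) : discInvolution m (discInvolution m w) = w := by
  have hne := one_sub_ofReal_mul_ne_zero hm0 hm1 hw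
  have h2 : (1 : ℂ) - (m : ℂ) ^ 2 ≠ 0 := by
    have : (1 : ℝ) - m ^ 2 ≠ 0 := by nlinarith
    exact_mod_cast this
  have h3 : (1 : ℂ) - m * ((m - w) / (1 - m * w)) ≠ 0 := by
    have : (1 : ℂ) - m * ((m - w) / (1 - m * w)) = (1 - (m : ℂ) ^ 2) / (1 - m * w) := by
      field_simp; ring
    rw [this]; exact div_ne_zero h2 hne
  unfold discInvolution
  rw [div_eq_iff h3]
  field_simp
  ring

theorem discInvolution_ofReal (m t : ℝ) :
    discInvolution m (t : ℂ) = (((m - t) / (1 - m * t) : ℝ) : ℂ) := by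
  simp [discInvolution]

/-- A consequence of the Schwarz–Pick lemma: a holomorphic self-map of the unit disc that keeps
the modulus of a point `w₀ > 0` cannot bring any point of `[0, w₀]` closer to the origin. -/
theorem le_norm_of_norm_eq_of_le {H : ℂ → ℂ} (hH : DifferentiableOn ℂ H (ball 0 1))
    (hb : ∀ v ∈ ball (0 : ℂ) 1, ‖H v‖ ≤ 1) {w₀ w : ℝ} (hw₀ : w₀ < 1) (hfix : ‖H w₀‖ = w₀)
    (hw : 0 ≤ w) (hww : w ≤ w₀) : w ≤ ‖H w‖ := by
  have hw₀0 : 0 ≤ w₀ := hw.trans hww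
  set a : ℂ := H w₀ with ha
  have hne : ∀ y : ℂ, ‖y‖ ≤ 1 → 1 - (starRingEnd ℂ) a * y ≠ 0 := by
    intro y hy h
    have h2 : ‖a‖ * ‖y‖ = 1 := by
      have := congrArg norm (sub_eq_zero.1 h).symm
      simpa using this
    rw [hfix] at h2
    nlinarith [norm_nonneg y]
  set P : ℂ → ℂ := fun v => (H (discInvolution w₀ v) - a) /
    (1 - (starRingEnd ℂ) a * H (discInvolution w₀ v)) with hP
  have hmaps : MapsTo (discInvolution w₀) (ball 0 1) (ball 0 1) := fun v hv => by
    rw [mem_ball_zero_iff] at hv ⊢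
    exact norm_discInvolution_lt_one hw₀0 hw₀ hv
  have hPd : DifferentiableOn ℂ P (ball 0 1) := by
    have hc := hH.comp (differentiableOn_discInvolution hw₀0 hw₀) hmaps
    refine DifferentiableOn.div (hc.sub_const a) ((hc.const_mul _).const_sub 1) fun v hv => ?_
    exact hne _ (hb _ (hmaps hv))
  have hPmaps : MapsTo P (ball 0 1) (closedBall 0 1) := fun v hv => by
    rw [mem_closedBall_zero_iff]
    have hy := hb _ (hmaps hv)
    have hpos : 0 < ‖1 - (starRingEnd ℂ) a * H (discInvolution w₀ v)‖ := norm_pos_iff.2 (hne _ hy)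
    simp only [hP]
    rw [norm_div, div_le_one hpos]
    have h := sq_norm_one_sub_conj_mul_sub a (H (discInvolution w₀ v))
    have h1 : 0 ≤ 1 - ‖a‖ ^ 2 := by rw [hfix]; nlinarith
    have h2 : 0 ≤ 1 - ‖H (discInvolution w₀ v)‖ ^ 2 := by
      nlinarith [norm_nonneg (H (discInvolution w₀ v))]
    exact le_of_sq_le_sq (by nlinarith [mul_nonneg h1 h2]) hpos.le
  have hP0 : P 0 = 0 := by
    simp [hP, discInvolution, ← ha]
  have hwn : ‖(w : ℂ)‖ < 1 := by
    rw [Complex.norm_real, Real.norm_eq_abs, abs_of_nonneg hw]; linarith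
  have hww₀ : 0 < 1 - w₀ * w := by nlinarith
  set δ : ℝ := (w₀ - w) / (1 - w₀ * w) with hδ
  have hδ0 : 0 ≤ δ := div_nonneg (by linarith) hww₀.le
  have hSch := Complex.norm_le_norm_of_mapsTo_ball hPd hPmaps hP0
    (z := discInvolution w₀ w) (norm_discInvolution_lt_one hw₀0 hw₀ hwn)
  simp only [hP] at hSch
  rw [discInvolution_discInvolution hw₀0 hw₀ hwn, discInvolution_ofReal, Complex.norm_real,
    Real.norm_eq_abs, abs_of_nonneg hδ0, norm_div,
    div_le_iff₀ (norm_pos_iff.2 (hne _ (hb _ (by simpa using hwn))))] at hSch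
  set b := ‖H w‖ with hbdef
  by_contra hlt
  push Not at hlt
  have hb0 : 0 ≤ b := norm_nonneg _
  have hid := sq_norm_one_sub_conj_mul_sub a (H w)
  rw [hfix, ← hbdef] at hid
  have htri : w₀ - b ≤ ‖H w - a‖ := by
    rw [← hfix, norm_sub_rev]; exact norm_sub_norm_le _ _
  have hδ1 : δ < 1 := by rw [hδ, div_lt_one hww₀]; nlinarith
  have hsq : ‖H w - a‖ ^ 2 ≤ δ ^ 2 * ‖1 - (starRingEnd ℂ) a * H w‖ ^ 2 := by
    rw [← mul_pow]; gcongr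
  have hsq2 : (w₀ - b) ^ 2 ≤ ‖H w - a‖ ^ 2 := pow_le_pow_left₀ (by linarith) htri 2
  have hδ2 : 0 ≤ 1 - δ ^ 2 := by nlinarith
  have hfin : (w₀ - b) ^ 2 ≤ (δ * (1 - w₀ * b)) ^ 2 := by
    have h1 : (1 - δ ^ 2) * (w₀ - b) ^ 2 ≤ (1 - δ ^ 2) * ‖H w - a‖ ^ 2 := by gcongr
    nlinarith
  have hle : w₀ - b ≤ δ * (1 - w₀ * b) :=
    le_of_sq_le_sq hfin (mul_nonneg hδ0 (by nlinarith))
  rw [hδ, div_mul_eq_mul_div, le_div_iff₀ hww₀] at hle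
  nlinarith [mul_pos (sub_pos.2 hlt) (by nlinarith : (0 : ℝ) < 1 - w₀ ^ 2)]

/-- The sharp lower bound for a function on the disc whose weighted modulus
`(1 - |ζ|²) ^ (β / 2) |g ζ|` is at most `1`, when the weighted modulus at `0` is that
of the extremal function `ζ ↦ ζ / (a κ)`, `κ = (1 - a²) ^ (β / 2)`, at a point `m < a`.
Moving `m` to the origin by an automorphism of weight `β / 2` turns `g` into a function that takes
at `m` the modulus of the extremal function and is bounded by `κ⁻¹` on the disc of radius `a`, so
that Schwarz–Pick applies. -/
theorem distortion_of_lt {β a m : ℝ} (hβ : 0 < β) (ha : 0 < a) (ha1 : a < 1)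
    {g : ℂ → ℂ} (hg : DifferentiableOn ℂ g (ball 0 1))
    (hgb : ∀ ζ ∈ ball (0 : ℂ) 1, (1 - ‖ζ‖ ^ 2) ^ (β / 2) * ‖g ζ‖ ≤ 1)
    (hm0 : 0 < m) (hma : m < a)
    (hg0 : a * (1 - a ^ 2) ^ (β / 2) * ‖g 0‖ = m * (1 - m ^ 2) ^ (β / 2))
    {t : ℝ} (ht0 : 0 ≤ t) (htm : t ≤ m) :
    (1 - m ^ 2) ^ (β / 2) * (m - t) ≤
      a * (1 - a ^ 2) ^ (β / 2) * ‖g t‖ * (1 - m * t) ^ (β + 1) := by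
  have hm1 : m < 1 := hma.trans ha1
  have hY : 0 < 1 - m ^ 2 := by nlinarith
  have hX : 0 < 1 - a ^ 2 := by nlinarith
  set κ := (1 - a ^ 2) ^ (β / 2) with hκ
  have hκ0 : 0 < κ := Real.rpow_pos_of_pos hX _
  set Y := (1 - m ^ 2) ^ (β / 2) with hYd
  have hY0 : 0 < Y := Real.rpow_pos_of_pos hY _
  have hYY : (1 - m ^ 2) ^ β = Y * Y := by
    rw [hYd, ← Real.rpow_add hY]; congr 1; ring
  -- `Y / (1 - m w) ^ β` is the power `β / 2` of the derivative of the involution, up to a unimodular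
  -- constant; the factors `κ` and `a` normalize the bound and the disc
  set H : ℂ → ℂ := fun v => ((κ * Y : ℝ) : ℂ) * g (discInvolution m (a * v)) /
    (1 - (m : ℂ) * (a * v)) ^ (β : ℂ) with hH
  have hav : ∀ v ∈ ball (0 : ℂ) 1, ‖(a : ℂ) * v‖ ≤ a ∧ ‖(a : ℂ) * v‖ < 1 := by
    intro v hv
    rw [mem_ball_zero_iff] at hv
    rw [norm_mul, Complex.norm_real, Real.norm_eq_abs, abs_of_pos ha]
    constructor <;> nlinarith
  have hHd : DifferentiableOn ℂ H (ball 0 1) := by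
    have hmaps : MapsTo (fun v : ℂ => discInvolution m (a * v)) (ball 0 1) (ball 0 1) :=
      fun v hv => mem_ball_zero_iff.2 (norm_discInvolution_lt_one hm0.le hm1 (hav v hv).2)
    have hψ : DifferentiableOn ℂ (fun v : ℂ => discInvolution m (a * v)) (ball 0 1) :=
      (differentiableOn_discInvolution hm0.le hm1).comp (by fun_prop)
        fun v hv => mem_ball_zero_iff.2 (hav v hv).2
    refine ((hg.comp hψ hmaps).const_mul _).div ?_ fun v hv => ?_
    · refine DifferentiableOn.cpow (by fun_prop) (by fun_prop) fun v hv => Or.inl ?_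
      exact re_one_sub_ofReal_mul_pos hm0.le hm1 (hav v hv).2
    · rw [Complex.cpow_ne_zero_iff]
      exact Or.inl (one_sub_ofReal_mul_ne_zero hm0.le hm1 (hav v hv).2)
  have hHn : ∀ v ∈ ball (0 : ℂ) 1, ‖H v‖ =
      κ * Y * ‖g (discInvolution m (a * v))‖ / ‖1 - (m : ℂ) * (a * v)‖ ^ β := by
    intro v hv
    simp only [hH]
    rw [norm_div, norm_mul, Complex.norm_cpow_real, Complex.norm_real, Real.norm_eq_abs,
      abs_of_pos (by positivity)]
  have hHb : ∀ v ∈ ball (0 : ℂ) 1, ‖H v‖ ≤ 1 := by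
    intro v hv
    rw [hHn v hv]
    obtain ⟨hwa, hw1⟩ := hav v hv
    set w := (a : ℂ) * v with hw
    have hZ : 0 < ‖1 - (m : ℂ) * w‖ :=
      norm_pos_iff.2 (one_sub_ofReal_mul_ne_zero hm0.le hm1 hw1)
    have hW : 0 < 1 - ‖w‖ ^ 2 := by nlinarith [norm_nonneg w]
    have h := hgb _ (mem_ball_zero_iff.2 (norm_discInvolution_lt_one hm0.le hm1 hw1))
    have hZβ : (‖1 - (m : ℂ) * w‖ ^ 2) ^ (β / 2) = ‖1 - (m : ℂ) * w‖ ^ β := by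
      rw [← Real.rpow_natCast, ← Real.rpow_mul hZ.le]; congr 1; push_cast; ring
    rw [one_sub_sq_norm_discInvolution hm0.le hm1 hw1, Real.div_rpow (by positivity) (by positivity),
      Real.mul_rpow hW.le hY.le, hZβ, ← hYd] at h
    have hκW : κ ≤ (1 - ‖w‖ ^ 2) ^ (β / 2) := by
      refine Real.rpow_le_rpow hX.le ?_ (by positivity)
      nlinarith [norm_nonneg w]
    refine le_trans ?_ h
    rw [div_mul_eq_mul_div]
    gcongr
  have hma1 : m / a < 1 := (div_lt_one ha).2 hma
  have hfix : ‖H ((m / a : ℝ) : ℂ)‖ = m / a := by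
    have hmem : ((m / a : ℝ) : ℂ) ∈ ball (0 : ℂ) 1 := by
      rw [mem_ball_zero_iff, Complex.norm_real, Real.norm_eq_abs, abs_of_pos (by positivity)]
      exact hma1
    have hmul : (a : ℂ) * ((m / a : ℝ) : ℂ) = (m : ℝ) := by
      rw [← Complex.ofReal_mul]; congr 1; field_simp
    rw [hHn _ hmem, hmul, discInvolution_ofReal, sub_self, zero_div]
    have : (1 : ℂ) - m * m = ((1 - m ^ 2 : ℝ) : ℂ) := by push_cast; ring
    rw [this, Complex.norm_real, Real.norm_eq_abs, abs_of_pos hY, hYY, Complex.ofReal_zero]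
    rw [div_eq_div_iff (by positivity) ha.ne']
    linear_combination Y * hg0
  have hmt : 0 < 1 - m * t := by nlinarith
  set w := (m - t) / (1 - m * t) with hwd
  have hw0 : 0 ≤ w := div_nonneg (by linarith) hmt.le
  have hwm : w ≤ m := by
    rw [hwd, div_le_iff₀ hmt]; nlinarith
  have hmain := le_norm_of_norm_eq_of_le hHd hHb (w := w / a) hma1 hfix (by positivity) (by gcongr)
  have hmem : ((w / a : ℝ) : ℂ) ∈ ball (0 : ℂ) 1 := by
    rw [mem_ball_zero_iff, Complex.norm_real, Real.norm_eq_abs, abs_of_nonneg (by positivity)]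
    exact lt_of_le_of_lt (by gcongr) hma1
  have hmul : (a : ℂ) * ((w / a : ℝ) : ℂ) = (w : ℝ) := by
    rw [← Complex.ofReal_mul]; congr 1; field_simp
  have htn : ‖(t : ℂ)‖ < 1 := by
    rw [Complex.norm_real, Real.norm_eq_abs, abs_of_nonneg ht0]; linarith
  have hψw : discInvolution m (w : ℂ) = t := by
    rw [hwd, ← discInvolution_ofReal, discInvolution_discInvolution hm0.le hm1 htn]
  have hden : (1 : ℂ) - m * (w : ℝ) = (((1 - m ^ 2) / (1 - m * t) : ℝ) : ℂ) := by
    have : 1 - m * w = (1 - m ^ 2) / (1 - m * t) := by rw [hwd]; field_simp; ring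
    rw [← this]; push_cast; ring
  rw [hHn _ hmem, hmul, hψw, hden, Complex.norm_real, Real.norm_eq_abs,
    abs_of_pos (by positivity), Real.div_rpow hY.le hmt.le, hYY, hwd] at hmain
  have hT : 0 < (1 - m * t) ^ β := Real.rpow_pos_of_pos hmt _
  rw [Real.rpow_add_one hmt.ne']
  rw [div_div, div_div_eq_mul_div, div_le_div_iff₀ (by positivity) (by positivity)] at hmain
  refine le_of_mul_le_mul_right ?_ hY0
  linarith

theorem hasDerivAt_mul_one_sub_sq_rpow {β x : ℝ} (hx : x ^ 2 < 1) :
    HasDerivAt (fun x : ℝ => x * (1 - x ^ 2) ^ (β / 2))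
      ((1 - x ^ 2) ^ (β / 2 - 1) * (1 - x ^ 2 * (β + 1))) x := by
  have hpos : 0 < 1 - x ^ 2 := by linarith
  have h1 : HasDerivAt (fun x : ℝ => 1 - x ^ 2) (-(2 * x)) x := by
    simpa using (hasDerivAt_pow 2 x).const_sub 1
  have h2 := (hasDerivAt_id x).mul (h1.rpow_const (p := β / 2) (Or.inl hpos.ne'))
  refine h2.congr_deriv ?_
  have : (1 - x ^ 2) ^ (β / 2) = (1 - x ^ 2) ^ (β / 2 - 1) * (1 - x ^ 2) := by
    rw [← Real.rpow_add_one hpos.ne']; congr 1; ring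
  simp only [id]
  rw [this]; ring

theorem strictMonoOn_mul_one_sub_sq_rpow {β a : ℝ} (ha1 : a < 1)
    (haβ : a ^ 2 * (β + 1) = 1) :
    StrictMonoOn (fun x : ℝ => x * (1 - x ^ 2) ^ (β / 2)) (Icc 0 a) := by
  have hlt : ∀ x ∈ Icc 0 a, x ^ 2 < 1 := fun x hx => by nlinarith [hx.1, hx.2]
  refine strictMonoOn_of_deriv_pos (convex_Icc 0 a) (fun x hx =>
    (hasDerivAt_mul_one_sub_sq_rpow (hlt x hx)).continuousAt.continuousWithinAt) fun x hx => ?_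
  rw [interior_Icc] at hx
  have h1 := hlt x (Ioo_subset_Icc_self hx)
  rw [(hasDerivAt_mul_one_sub_sq_rpow h1).deriv]
  refine mul_pos (Real.rpow_pos_of_pos (by linarith) _) ?_
  have hxa : x ^ 2 < a ^ 2 := by nlinarith [hx.1, hx.2]
  have hb : 0 < β + 1 := by
    by_contra h
    nlinarith [sq_nonneg a]
  nlinarith

/-- The sharp lower bound of `distortion_of_lt` also holds for `m = a`: shrink `g` by a constant
factor to replace `m` by a smaller `m'`, and let `m'` tend to `m`. -/
theorem distortion_of_le {β a m : ℝ} (hβ : 0 < β) (ha : 0 < a) (ha1 : a < 1)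
    (haβ : a ^ 2 * (β + 1) = 1)
    {g : ℂ → ℂ} (hg : DifferentiableOn ℂ g (ball 0 1))
    (hgb : ∀ ζ ∈ ball (0 : ℂ) 1, (1 - ‖ζ‖ ^ 2) ^ (β / 2) * ‖g ζ‖ ≤ 1)
    (hm0 : 0 < m) (hma : m ≤ a)
    (hg0 : a * (1 - a ^ 2) ^ (β / 2) * ‖g 0‖ = m * (1 - m ^ 2) ^ (β / 2))
    {t : ℝ} (ht0 : 0 ≤ t) (htm : t < m) :
    (1 - m ^ 2) ^ (β / 2) * (m - t) ≤
      a * (1 - a ^ 2) ^ (β / 2) * ‖g t‖ * (1 - m * t) ^ (β + 1) := by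
  have hm1 : m < 1 := hma.trans_lt ha1
  have hY : 0 < 1 - m ^ 2 := by nlinarith
  have hX : 0 < 1 - a ^ 2 := by nlinarith
  have hκ0 : 0 < (1 - a ^ 2) ^ (β / 2) := Real.rpow_pos_of_pos hX _
  have hΦ : 0 < m * (1 - m ^ 2) ^ (β / 2) := mul_pos hm0 (Real.rpow_pos_of_pos hY _)
  have key : ∀ᶠ m' in 𝓝[<] m, (1 - m' ^ 2) ^ (β / 2) * (m' - t) ≤
      a * (1 - a ^ 2) ^ (β / 2) * ‖g t‖ * (1 - m' * t) ^ (β + 1) := by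
    filter_upwards [Ioo_mem_nhdsLT htm] with m' hm'
    have hm'0 : 0 < m' := ht0.trans_lt hm'.1
    have hm'1 : m' < 1 := hm'.2.trans hm1
    have hY' : 0 < 1 - m' ^ 2 := by nlinarith
    set c := m' * (1 - m' ^ 2) ^ (β / 2) / (m * (1 - m ^ 2) ^ (β / 2)) with hc
    have hc0 : 0 ≤ c := div_nonneg (mul_nonneg hm'0.le (Real.rpow_nonneg hY'.le _)) hΦ.le
    have hc1 : c ≤ 1 := (div_le_one hΦ).2
      (strictMonoOn_mul_one_sub_sq_rpow ha1 haβ ⟨hm'0.le, hm'.2.le.trans hma⟩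
        ⟨hm0.le, hma⟩ hm'.2).le
    have hcn : ∀ ζ, ‖(c : ℂ) * g ζ‖ = c * ‖g ζ‖ := fun ζ => by
      rw [norm_mul, Complex.norm_real, Real.norm_eq_abs, abs_of_nonneg hc0]
    have hmt : 0 < 1 - m' * t := by nlinarith [hm'.1]
    have := distortion_of_lt hβ ha ha1 (g := fun ζ => (c : ℂ) * g ζ) (m := m') (hg.const_mul _)
      (fun ζ hζ => by
        rw [hcn]
        have h1 := hgb ζ hζ
        rw [mem_ball_zero_iff] at hζ
        have h2 : 0 ≤ (1 - ‖ζ‖ ^ 2) ^ (β / 2) * ‖g ζ‖ :=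
          mul_nonneg (Real.rpow_nonneg (by nlinarith [norm_nonneg ζ]) _) (norm_nonneg _)
        calc _ = c * ((1 - ‖ζ‖ ^ 2) ^ (β / 2) * ‖g ζ‖) := by ring
          _ ≤ 1 := mul_le_one₀ hc1 h2 h1)
      hm'0 (hm'.2.trans_le hma)
      (by rw [hcn, ← mul_assoc, mul_right_comm, hg0, hc]; field_simp) ht0 hm'.1.le
    refine this.trans ?_
    rw [hcn]
    have hR : 0 ≤ (1 - m' * t) ^ (β + 1) := Real.rpow_nonneg hmt.le _
    gcongr
    exact mul_le_of_le_one_left (norm_nonneg _) hc1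
  have hL : Tendsto (fun m' : ℝ => (1 - m' ^ 2) ^ (β / 2) * (m' - t)) (𝓝[<] m)
      (𝓝 ((1 - m ^ 2) ^ (β / 2) * (m - t))) := by
    have : ContinuousAt (fun m' : ℝ => (1 - m' ^ 2) ^ (β / 2) * (m' - t)) m :=
      ContinuousAt.mul (ContinuousAt.rpow_const (by fun_prop) (Or.inl hY.ne')) (by fun_prop)
    exact this.tendsto.mono_left nhdsWithin_le_nhds
  have hR : Tendsto (fun m' : ℝ => a * (1 - a ^ 2) ^ (β / 2) * ‖g t‖ * (1 - m' * t) ^ (β + 1))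
      (𝓝[<] m) (𝓝 (a * (1 - a ^ 2) ^ (β / 2) * ‖g t‖ * (1 - m * t) ^ (β + 1))) := by
    have : ContinuousAt
        (fun m' : ℝ => a * (1 - a ^ 2) ^ (β / 2) * ‖g t‖ * (1 - m' * t) ^ (β + 1)) m :=
      ContinuousAt.mul continuousAt_const
        (ContinuousAt.rpow_const (by fun_prop) (Or.inl (by nlinarith)))
    exact this.tendsto.mono_left nhdsWithin_le_nhds
  exact le_of_tendsto_of_tendsto hL hR key

end Distortion

/-! ### Schlicht domains -/

section Schlicht

variable {n : ℕ} {f : CSpace n → CSpace n} {U V : Set (CSpace n)} {r : ℝ}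

theorem hasStrictFDerivAt_equiv_of_det_ne_zero (hf : HolomorphicOnBall f) {x : CSpace n}
    (hx : x ∈ unitBall n) (hdet : (fderiv ℂ f x).det ≠ 0) :
    HasStrictFDerivAt f (((fderiv ℂ f x).toContinuousLinearEquivOfDetNeZero hdet :
      CSpace n ≃L[ℂ] CSpace n) : CSpace n →L[ℂ] CSpace n) x := by
  rw [ContinuousLinearMap.coe_toContinuousLinearEquivOfDetNeZero]
  exact hasStrictFDerivAt_of_differentiableOn hf (isOpen_ball.mem_nhds hx)

/-- `U` is an open subset of the unit ball, containing the origin, on which `f` is injective with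
nonvanishing Jacobian, and whose image is the ball of centre `f 0` and radius `r`. -/
structure IsSchlichtDomain (f : CSpace n → CSpace n) (U : Set (CSpace n)) (r : ℝ) : Prop where
  isOpen : IsOpen U
  subset : U ⊆ unitBall n
  zero_mem : 0 ∈ U
  injOn : InjOn f U
  image_eq : f '' U = ball (f 0) r
  det_ne_zero : ∀ x ∈ U, (fderiv ℂ f x).det ≠ 0

theorem IsSchlichtDomain.radius_pos (h : IsSchlichtDomain f U r) : 0 < r := by
  have hmem : f 0 ∈ f '' U := mem_image_of_mem f h.zero_mem
  rw [h.image_eq] at hmem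
  exact nonempty_ball.1 ⟨_, hmem⟩

theorem IsSchlichtDomain.invOn (h : IsSchlichtDomain f U r) :
    InvOn (Function.invFunOn f U) f U (ball (f 0) r) :=
  h.image_eq ▸ ⟨h.injOn.leftInvOn_invFunOn, (surjOn_image f U).rightInvOn_invFunOn⟩

theorem IsSchlichtDomain.mapsTo_inv (h : IsSchlichtDomain f U r) :
    MapsTo (Function.invFunOn f U) (ball (f 0) r) U :=
  h.image_eq ▸ (surjOn_image f U).mapsTo_invFunOn

theorem IsSchlichtDomain.mapsTo (h : IsSchlichtDomain f U r) : MapsTo f U (ball (f 0) r) :=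
  h.image_eq ▸ mapsTo_image f U

theorem IsSchlichtDomain.hasFDerivAt_inv (h : IsSchlichtDomain f U r) (hf : HolomorphicOnBall f)
    {x : CSpace n} (hx : x ∈ U) : HasFDerivAt (Function.invFunOn f U)
      ((((fderiv ℂ f x).toContinuousLinearEquivOfDetNeZero (h.det_ne_zero x hx)).symm :
        CSpace n ≃L[ℂ] CSpace n) : CSpace n →L[ℂ] CSpace n) (f x) :=
  ((hasStrictFDerivAt_equiv_of_det_ne_zero hf (h.subset hx)
    (h.det_ne_zero x hx)).to_local_left_inverse
      (Filter.mem_of_superset (h.isOpen.mem_nhds hx) fun _ hy => h.invOn.1 hy)).hasFDerivAt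

theorem IsSchlichtDomain.differentiableOn_inv (h : IsSchlichtDomain f U r)
    (hf : HolomorphicOnBall f) :
    DifferentiableOn ℂ (Function.invFunOn f U) (ball (f 0) r) := fun w hw => by
  have hd := h.hasFDerivAt_inv hf (h.mapsTo_inv hw)
  rw [h.invOn.2 hw] at hd
  exact hd.differentiableAt.differentiableWithinAt

/-- On the image ball, the derivative of the inverse inverts `f'`. -/
theorem IsSchlichtDomain.fderiv_fderiv_inv (h : IsSchlichtDomain f U r)
    (hf : HolomorphicOnBall f) {x : CSpace n} (hx : x ∈ U) (v : CSpace n) :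
    fderiv ℂ f x (fderiv ℂ (Function.invFunOn f U) (f x) v) = v := by
  rw [(h.hasFDerivAt_inv hf hx).fderiv]
  have := ((fderiv ℂ f x).toContinuousLinearEquivOfDetNeZero (h.det_ne_zero x hx)).apply_symm_apply v
  rwa [ContinuousLinearMap.toContinuousLinearEquivOfDetNeZero_apply] at this

theorem IsSchlichtDomain.isSchlichtBall (h : IsSchlichtDomain f U r) (hf : HolomorphicOnBall f) :
    IsSchlichtBall f 0 r :=
  ⟨h.radius_pos, U, h.isOpen, h.subset, h.zero_mem, hf.mono h.subset, h.mapsTo,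
    Function.invFunOn f U, h.differentiableOn_inv hf, h.mapsTo_inv, h.invOn⟩

theorem IsSchlichtBall.exists_domain (h : IsSchlichtBall f 0 r) :
    ∃ U, IsSchlichtDomain f U r := by
  obtain ⟨-, U, hUo, hUs, h0, hfd, hmaps, g, hgd, hgmaps, hinv⟩ := h
  refine ⟨U, hUo, hUs, h0, hinv.1.injOn, ?_, fun x hx => ?_⟩
  · exact (hinv.2.surjOn hgmaps).image_eq_of_mapsTo hmaps
  · have hfx : HasFDerivAt f (fderiv ℂ f x) x := (hfd.differentiableAt (hUo.mem_nhds hx)).hasFDerivAt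
    have hgx : HasFDerivAt g (fderiv ℂ g (f x)) (f x) :=
      (hgd.differentiableAt (isOpen_ball.mem_nhds (hmaps hx))).hasFDerivAt
    have hid : HasFDerivAt (g ∘ f) (ContinuousLinearMap.id ℂ (CSpace n)) x :=
      (hasFDerivAt_id x).congr_of_eventuallyEq
        (Filter.mem_of_superset (hUo.mem_nhds hx) fun y hy => hinv.1 hy)
    have hcomp := (hgx.comp x hfx).unique hid
    intro hzero
    have hd := congrArg ContinuousLinearMap.det hcomp
    simp only [ContinuousLinearMap.det, ContinuousLinearMap.toLinearMap_comp, LinearMap.det_comp,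
      ContinuousLinearMap.coe_id, LinearMap.det_id] at hd hzero
    rw [hzero, mul_zero] at hd
    exact zero_ne_one hd

/-- By the Schwarz lemma for the inverse map, schlicht radii are at most `‖f' 0‖`. -/
theorem IsSchlichtDomain.radius_le (hn : 1 ≤ n) (h : IsSchlichtDomain f U r)
    (hf : HolomorphicOnBall f) : r ≤ ‖fderiv ℂ f 0‖ := by
  have : Nonempty (Fin n) := ⟨⟨0, hn⟩⟩
  have hr := h.radius_pos
  have hg0 : Function.invFunOn f U (f 0) = 0 := h.invOn.1 h.zero_mem
  have hmaps : MapsTo (Function.invFunOn f U) (ball (f 0) r)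
      (closedBall (Function.invFunOn f U (f 0)) 1) := by
    rw [hg0]
    exact fun w hw => ball_subset_closedBall (h.subset (h.mapsTo_inv hw))
  have hle := Complex.norm_fderiv_le_div_of_mapsTo_ball (h.differentiableOn_inv hf) hmaps hr
  obtain ⟨v, hv⟩ := exists_ne (0 : CSpace n)
  have hv' : 0 < ‖v‖ := norm_pos_iff.2 hv
  have h1 : ‖v‖ ≤ ‖fderiv ℂ f 0‖ * (1 / r * ‖v‖) := by
    calc ‖v‖ = ‖fderiv ℂ f 0 (fderiv ℂ (Function.invFunOn f U) (f 0) v)‖ := by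
          rw [h.fderiv_fderiv_inv hf h.zero_mem]
      _ ≤ ‖fderiv ℂ f 0‖ * (‖fderiv ℂ (Function.invFunOn f U) (f 0)‖ * ‖v‖) :=
          (ContinuousLinearMap.le_opNorm _ _).trans
            (by gcongr; exact ContinuousLinearMap.le_opNorm _ _)
      _ ≤ _ := by gcongr
  have h2 : ‖fderiv ℂ f 0‖ * (1 / r * ‖v‖) = ‖fderiv ℂ f 0‖ / r * ‖v‖ := by ring
  rw [h2, le_mul_iff_one_le_left hv', one_le_div hr] at h1
  exact h1

/-- Schlicht domains grow with the radius: the inverse maps agree at `f 0`, and the set where they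
agree is open and closed in the smaller ball. -/
theorem IsSchlichtDomain.subset_of_le {r' : ℝ} (h : IsSchlichtDomain f U r)
    (h' : IsSchlichtDomain f V r') (hf : HolomorphicOnBall f) (hr : r ≤ r') : U ⊆ V := by
  set g := Function.invFunOn f U with hg
  set g' := Function.invFunOn f V with hg'
  have hgc : ContinuousOn g (ball (f 0) r) := (h.differentiableOn_inv hf).continuousOn
  have hg'c : ContinuousOn g' (ball (f 0) r) :=
    (h'.differentiableOn_inv hf).continuousOn.mono (ball_subset_ball hr)
  set T := {w | w ∈ ball (f 0) r ∧ g w = g' w} with hT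
  have hTo : IsOpen T := by
    refine isOpen_iff_mem_nhds.2 fun w ⟨hw, hgw⟩ => ?_
    have hmem : g w ∈ V := hgw ▸ h'.mapsTo_inv (ball_subset_ball hr hw)
    have hnear := (hgc.continuousAt (isOpen_ball.mem_nhds hw)) (h'.isOpen.mem_nhds hmem)
    filter_upwards [isOpen_ball.mem_nhds hw, hnear] with y hy hyV
    refine ⟨hy, ?_⟩
    have h1 : g' (f (g y)) = g y := h'.invOn.1 hyV
    rwa [h.invOn.2 hy, eq_comm] at h1
  have hclosed : closure T ∩ ball (f 0) r ⊆ T := by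
    rintro w ⟨hwT, hw⟩
    refine ⟨hw, ?_⟩
    have : NeBot (𝓝[T] w) := mem_closure_iff_nhdsWithin_neBot.1 hwT
    have h1 : Tendsto g (𝓝[T] w) (𝓝 (g w)) :=
      (hgc.continuousAt (isOpen_ball.mem_nhds hw)).tendsto.mono_left nhdsWithin_le_nhds
    have h2 : Tendsto g' (𝓝[T] w) (𝓝 (g' w)) :=
      (hg'c.continuousAt (isOpen_ball.mem_nhds hw)).tendsto.mono_left nhdsWithin_le_nhds
    refine tendsto_nhds_unique h1 (h2.congr' ?_)
    filter_upwards [self_mem_nhdsWithin] with y hy using hy.2.symm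
  have hf0 : f 0 ∈ ball (f 0) r := mem_ball_self h.radius_pos
  have hsub := (convex_ball (f 0) r).isPreconnected.subset_of_closure_inter_subset hTo
    ⟨f 0, hf0, hf0, (h.invOn.1 h.zero_mem).trans (h'.invOn.1 h'.zero_mem).symm⟩ hclosed
  intro x hx
  have h1 : Function.invFunOn f U (f x) = Function.invFunOn f V (f x) := (hsub (h.mapsTo hx)).2
  rw [h.invOn.1 hx] at h1
  rw [h1]
  exact h'.mapsTo_inv (ball_subset_ball hr (h.mapsTo hx))

/-- An open set on which `f` is injective with nonvanishing Jacobian can be cut down to a schlicht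
domain of every radius whose ball lies in its image. -/
theorem isSchlichtDomain_inter_preimage (hf : HolomorphicOnBall f) (hV : IsOpen V)
    (hVs : V ⊆ unitBall n) (h0 : 0 ∈ V) (hinj : InjOn f V)
    (hdet : ∀ x ∈ V, (fderiv ℂ f x).det ≠ 0) (hr : 0 < r) (hball : ball (f 0) r ⊆ f '' V) :
    IsSchlichtDomain f (V ∩ f ⁻¹' ball (f 0) r) r := by
  have hfV : ContinuousOn f V := hf.continuousOn.mono hVs
  refine ⟨?_, ?_, ?_, ?_, ?_, ?_⟩
  · exact hfV.isOpen_inter_preimage hV isOpen_ball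
  · exact inter_subset_left.trans hVs
  · have h0r : f 0 ∈ ball (f 0) r := mem_ball_self hr
    exact mem_inter h0 (mem_preimage.2 h0r)
  · exact hinj.mono inter_subset_left
  · rw [image_inter_preimage, inter_eq_right.2 hball]
  · exact fun x hx => hdet x hx.1

theorem isOpen_image_of_det_ne_zero (hf : HolomorphicOnBall f) (hV : IsOpen V)
    (hVs : V ⊆ unitBall n) (hdet : ∀ x ∈ V, (fderiv ℂ f x).det ≠ 0) : IsOpen (f '' V) := by
  refine isOpen_iff_mem_nhds.2 ?_
  rintro _ ⟨x, hx, rfl⟩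
  rw [← (hasStrictFDerivAt_equiv_of_det_ne_zero hf (hVs hx) (hdet x hx)).map_nhds_eq_of_equiv]
  exact image_mem_map (hV.mem_nhds hx)

theorem exists_nhds_injOn_of_det_ne_zero (hf : HolomorphicOnBall f) {x : CSpace n}
    (hx : x ∈ unitBall n) (hdet : (fderiv ℂ f x).det ≠ 0) : ∃ u ∈ 𝓝 x, InjOn f u := by
  have hs := hasStrictFDerivAt_equiv_of_det_ne_zero hf hx hdet
  refine ⟨(hs.toOpenPartialHomeomorph f).source,
    (hs.toOpenPartialHomeomorph f).open_source.mem_nhds hs.mem_toOpenPartialHomeomorph_source, ?_⟩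
  simpa using (hs.toOpenPartialHomeomorph f).injOn

theorem exists_isSchlichtBall (hf : HolomorphicOnBall f) {m : ℝ} (hm0 : 0 < m) (hm1 : m ≤ 1)
    (hdet : ∀ x ∈ ball (0 : CSpace n) m, (fderiv ℂ f x).det ≠ 0) :
    ∃ r, IsSchlichtBall f 0 r := by
  have hsub : ball (0 : CSpace n) m ⊆ unitBall n := ball_subset_ball hm1
  have h0 : (0 : CSpace n) ∈ ball (0 : CSpace n) m := mem_ball_self hm0
  obtain ⟨u, hu, huinj⟩ := exists_nhds_injOn_of_det_ne_zero hf (hsub h0) (hdet 0 h0)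
  obtain ⟨t, htu, hto, ht0⟩ := _root_.mem_nhds_iff.1 hu
  have hVo : IsOpen (t ∩ ball (0 : CSpace n) m) := hto.inter isOpen_ball
  have hVs : t ∩ ball (0 : CSpace n) m ⊆ unitBall n := inter_subset_right.trans hsub
  have hVd : ∀ x ∈ t ∩ ball (0 : CSpace n) m, (fderiv ℂ f x).det ≠ 0 := fun x hx => hdet x hx.2
  obtain ⟨r, hr, hball⟩ := Metric.isOpen_iff.1 (isOpen_image_of_det_ne_zero hf hVo hVs hVd) (f 0)
    (mem_image_of_mem f ⟨ht0, h0⟩)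
  exact ⟨r, (isSchlichtDomain_inter_preimage hf hVo hVs ⟨ht0, h0⟩
    (huinj.mono (inter_subset_left.trans htu)) hVd hr hball).isSchlichtBall hf⟩

/-- The union of all schlicht domains is a schlicht domain, so the supremum of the schlicht radii is
attained. -/
theorem isGreatest_schlichtRadius (hn : 1 ≤ n) (hf : HolomorphicOnBall f)
    (hne : ∃ r, IsSchlichtBall f 0 r) :
    IsGreatest {r : ℝ | IsSchlichtBall f 0 r} (schlichtRadius 0 f) := by
  have hbdd : BddAbove {r : ℝ | IsSchlichtBall f 0 r} := by
    refine ⟨‖fderiv ℂ f 0‖, fun r hr => ?_⟩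
    obtain ⟨U, hU⟩ := IsSchlichtBall.exists_domain hr
    exact hU.radius_le hn hf
  have hlub : IsLUB {r : ℝ | IsSchlichtBall f 0 r} (schlichtRadius 0 f) := isLUB_csSup hne hbdd
  refine ⟨?_, hlub.1⟩
  set W : Set (CSpace n) := ⋃ (U) (r) (_ : IsSchlichtDomain f U r), U with hW
  have hmemW : ∀ {x}, x ∈ W ↔ ∃ U r, IsSchlichtDomain f U r ∧ x ∈ U := by
    intro x; simp [hW]
  obtain ⟨r₀, hr₀⟩ := hne
  obtain ⟨U₀, hU₀⟩ := hr₀.exists_domain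
  have hdom : IsSchlichtDomain f W (schlichtRadius 0 f) := by
    refine ⟨?_, ?_, hmemW.2 ⟨U₀, r₀, hU₀, hU₀.zero_mem⟩, ?_, ?_, ?_⟩
    · exact isOpen_iUnion fun U => isOpen_iUnion fun r => isOpen_iUnion fun h => h.isOpen
    · intro x hx
      obtain ⟨U, r, h, hxU⟩ := hmemW.1 hx
      exact h.subset hxU
    · intro x hx y hy hxy
      obtain ⟨U, r, h, hxU⟩ := hmemW.1 hx
      obtain ⟨V, s, h', hyV⟩ := hmemW.1 hy
      rcases le_total r s with hrs | hrs
      · exact h'.injOn (h.subset_of_le h' hf hrs hxU) hyV hxy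
      · exact h.injOn hxU (h'.subset_of_le h hf hrs hyV) hxy
    · refine Subset.antisymm ?_ fun w hw => ?_
      · rintro _ ⟨x, hx, rfl⟩
        obtain ⟨U, r, h, hxU⟩ := hmemW.1 hx
        exact ball_subset_ball (hlub.1 (h.isSchlichtBall hf)) (h.mapsTo hxU)
      · obtain ⟨r, hr, hwr, -⟩ := hlub.exists_between (mem_ball.1 hw)
        obtain ⟨U, hU⟩ := IsSchlichtBall.exists_domain hr
        obtain ⟨x, hx, rfl⟩ := hU.image_eq.symm.subset (mem_ball.2 hwr)
        exact ⟨x, hmemW.2 ⟨U, r, hU, hx⟩, rfl⟩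
    · intro x hx
      obtain ⟨U, r, h, hxU⟩ := hmemW.1 hx
      exact h.det_ne_zero x hxU
  exact hdom.isSchlichtBall hf

/-- If a schlicht domain stays away from the zeros of the Jacobian and `f` expands uniformly on it,
then its radius is not maximal: `f` is injective on its compact closure, hence on a neighbourhood
of the closure. -/
theorem IsSchlichtDomain.exists_radius_gt (h : IsSchlichtDomain f U r) (hf : HolomorphicOnBall f)
    {m ρ c : ℝ} (hm1 : m ≤ 1) (hdet : ∀ x ∈ ball (0 : CSpace n) m, (fderiv ℂ f x).det ≠ 0)
    (hρm : ρ < m) (hUρ : U ⊆ closedBall 0 ρ) (hc : 0 < c)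
    (hexp : ∀ x ∈ U, ∀ v, c * ‖v‖ ≤ ‖fderiv ℂ f x v‖) :
    ∃ r' > r, IsSchlichtBall f 0 r' := by
  have hr := h.radius_pos
  have hlip : ∀ x ∈ U, ∀ y ∈ U, ‖x - y‖ ≤ c⁻¹ * ‖f x - f y‖ := by
    intro x hx y hy
    have := (convex_ball (f 0) r).norm_image_sub_le_of_norm_fderiv_le (𝕜 := ℂ)
      (f := Function.invFunOn f U) (C := c⁻¹)
      (fun w hw => (h.differentiableOn_inv hf).differentiableAt (isOpen_ball.mem_nhds hw))
      (fun w hw => by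
        refine ContinuousLinearMap.opNorm_le_bound _ (by positivity) fun v => ?_
        have h1 := hexp _ (h.mapsTo_inv hw) (fderiv ℂ (Function.invFunOn f U) w v)
        have h2 := h.fderiv_fderiv_inv hf (h.mapsTo_inv hw) v
        rw [h.invOn.2 hw] at h2
        rw [h2] at h1
        rwa [inv_mul_eq_div, le_div_iff₀' hc])
      (h.mapsTo hy) (h.mapsTo hx)
    rwa [h.invOn.1 hx, h.invOn.1 hy] at this
  have hCρ : closure U ⊆ closedBall 0 ρ := closure_minimal hUρ isClosed_closedBall
  have hCm : closure U ⊆ ball 0 m := hCρ.trans (closedBall_subset_ball hρm)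
  have hms : ball (0 : CSpace n) m ⊆ unitBall n := ball_subset_ball hm1
  have hfc : ∀ x ∈ closure U, ContinuousAt f x := fun x hx =>
    (hf.differentiableAt (isOpen_ball.mem_nhds (hms (hCm hx)))).continuousAt
  have hCc : IsCompact (closure U) := (isCompact_closedBall 0 ρ).of_isClosed_subset isClosed_closure hCρ
  have hinjC : InjOn f (closure U) := by
    intro x hx y hy hxy
    have hle : ‖x - y‖ ≤ c⁻¹ * ‖f x - f y‖ := by
      have hmem : (x, y) ∈ closure (U ×ˢ U) := by rw [closure_prod_eq]; exact ⟨hx, hy⟩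
      have h1 : ContinuousAt (fun p : CSpace n × CSpace n => f p.1) (x, y) :=
        ContinuousAt.comp (f := Prod.fst) (g := f) (x := (x, y)) (hfc x hx) continuousAt_fst
      have h2 : ContinuousAt (fun p : CSpace n × CSpace n => f p.2) (x, y) :=
        ContinuousAt.comp (f := Prod.snd) (g := f) (x := (x, y)) (hfc y hy) continuousAt_snd
      have h3 : ContinuousAt (fun p : CSpace n × CSpace n => c⁻¹ * ‖f p.1 - f p.2‖) (x, y) :=
        continuousAt_const.mul (h1.sub h2).norm
      have h4 : ContinuousAt (fun p : CSpace n × CSpace n => ‖p.1 - p.2‖) (x, y) :=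
        (continuousAt_fst.sub continuousAt_snd).norm
      exact ContinuousWithinAt.closure_le hmem h4.continuousWithinAt h3.continuousWithinAt
        fun p hp => hlip p.1 hp.1 p.2 hp.2
    rw [hxy, sub_self, norm_zero, mul_zero] at hle
    exact sub_eq_zero.1 (norm_le_zero_iff.1 hle)
  obtain ⟨t, hto, hCt, htinj⟩ := hinjC.exists_isOpen_superset hCc hfc fun x hx =>
    exists_nhds_injOn_of_det_ne_zero hf (hms (hCm hx)) (hdet x (hCm hx))
  have hVo : IsOpen (t ∩ ball (0 : CSpace n) m) := hto.inter isOpen_ball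
  have hVs : t ∩ ball (0 : CSpace n) m ⊆ unitBall n := inter_subset_right.trans hms
  have hVd : ∀ x ∈ t ∩ ball (0 : CSpace n) m, (fderiv ℂ f x).det ≠ 0 := fun x hx => hdet x hx.2
  have hclosed : IsClosed (f '' closure U) :=
    (hCc.image_of_continuousOn fun x hx => (hfc x hx).continuousWithinAt).isClosed
  have hsub : closedBall (f 0) r ⊆ f '' (t ∩ ball (0 : CSpace n) m) := by
    rw [← closure_ball (f 0) hr.ne', ← h.image_eq]
    exact (closure_minimal (image_mono subset_closure) hclosed).trans
      (image_mono (subset_inter hCt hCm))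
  obtain ⟨δ, hδ, hthick⟩ := (isCompact_closedBall (f 0) r).exists_thickening_subset_open
    (isOpen_image_of_det_ne_zero hf hVo hVs hVd) hsub
  rw [thickening_closedBall hδ hr.le] at hthick
  have h0 : (0 : CSpace n) ∈ closure U := subset_closure h.zero_mem
  exact ⟨δ + r, by linarith, (isSchlichtDomain_inter_preimage hf hVo hVs ⟨hCt h0, hCm h0⟩
    (htinj.mono inter_subset_left) hVd (by linarith) hthick).isSchlichtBall hf⟩

/-- A schlicht domain of radius `H ρ` lies in the closed ball of radius `ρ`, when `f` expands lengths
at `x` by at least `H' ‖x‖`: the preimage of the segment `s ↦ f 0 + κ H(s) e`, `κ < 1`, moves with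
speed less than `1` whenever it is at distance `s` from the origin. -/
theorem IsSchlichtDomain.subset_closedBall (h : IsSchlichtDomain f U r) (hf : HolomorphicOnBall f)
    {H H' : ℝ → ℝ} {ρ : ℝ} (hρ : 0 ≤ ρ) (hH0 : H 0 = 0) (hHρ : H ρ = r)
    (hHd : ∀ s ∈ Icc 0 ρ, HasDerivAt H (H' s) s) (hHpos : ∀ s ∈ Icc 0 ρ, 0 < H' s)
    (hexp : ∀ x ∈ U, ‖x‖ ≤ ρ → ∀ v, H' ‖x‖ * ‖v‖ ≤ ‖fderiv ℂ f x v‖) :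
    U ⊆ closedBall 0 ρ := by
  have hr := h.radius_pos
  have hHc : ContinuousOn H (Icc 0 ρ) := fun s hs => (hHd s hs).continuousAt.continuousWithinAt
  have hmono : MonotoneOn H (Icc 0 ρ) := by
    refine monotoneOn_of_deriv_nonneg (convex_Icc 0 ρ) hHc (fun s hs => ?_) fun s hs => ?_
    · exact (hHd s (interior_subset hs)).differentiableAt.differentiableWithinAt
    · rw [(hHd s (interior_subset hs)).deriv]; exact (hHpos s (interior_subset hs)).le
  intro x hx
  rw [mem_closedBall_zero_iff]
  set d := ‖f x - f 0‖ with hd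
  have hdr : d < r := by rw [hd, ← dist_eq_norm]; exact h.mapsTo hx
  rcases (norm_nonneg (f x - f 0)).eq_or_lt with h0 | hd0
  · have : x = 0 := h.injOn hx h.zero_mem (sub_eq_zero.1 (norm_eq_zero.1 h0.symm))
    simpa [this] using hρ
  rw [← hd] at hd0
  obtain ⟨κ, hκl, hκ1⟩ := exists_between ((div_lt_one hr).2 hdr)
  have hκ0 : 0 < κ := lt_trans (by positivity) hκl
  set e : CSpace n := d⁻¹ • (f x - f 0) with he
  have hen : ‖e‖ = 1 := by
    rw [he, norm_smul, Real.norm_eq_abs, abs_of_pos (by positivity), ← hd,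
      inv_mul_cancel₀ hd0.ne']
  have hHnn : ∀ s ∈ Icc 0 ρ, 0 ≤ H s := fun s hs => by
    rw [← hH0]; exact hmono ⟨le_rfl, hρ⟩ hs hs.1
  have hHle : ∀ s ∈ Icc 0 ρ, H s ≤ r := fun s hs => by
    rw [← hHρ]; exact hmono hs ⟨hρ, le_rfl⟩ hs.2
  set p : ℝ → CSpace n := fun s => f 0 + (κ * H s) • e with hp
  have hpmem : ∀ s ∈ Icc 0 ρ, p s ∈ ball (f 0) r := fun s hs => by
    rw [hp, mem_ball, dist_self_add_left, norm_smul, hen, mul_one, Real.norm_eq_abs,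
      abs_of_nonneg (mul_nonneg hκ0.le (hHnn s hs))]
    nlinarith [hHnn s hs, hHle s hs]
  set g := Function.invFunOn f U with hg
  have hder : ∀ s ∈ Icc 0 ρ, HasDerivAt (fun s => g (p s))
      (fderiv ℂ g (p s) ((κ * H' s) • e)) s := by
    intro s hs
    have h1 : HasDerivAt p ((κ * H' s) • e) s :=
      (((hHd s hs).const_mul κ).smul_const e).const_add (f 0)
    have h2 : HasFDerivAt g (fderiv ℂ g (p s)) (p s) :=
      ((h.differentiableOn_inv hf).differentiableAt
        (isOpen_ball.mem_nhds (hpmem s hs))).hasFDerivAt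
    exact (h2.restrictScalars ℝ).comp_hasDerivAt s h1
  have hbound := image_norm_le_of_norm_deriv_right_lt_deriv_boundary'
    (f := fun s => g (p s)) (a := 0) (b := ρ) (B := fun s => s) (B' := fun _ => 1)
    (f' := fun s => fderiv ℂ g (p s) ((κ * H' s) • e))
    (fun s hs => (hder s hs).continuousAt.continuousWithinAt)
    (fun s hs => (hder s (Ico_subset_Icc_self hs)).hasDerivWithinAt)
    (by simp [hp, hH0, hg, h.invOn.1 h.zero_mem])
    continuousOn_id (fun s _ => hasDerivWithinAt_id s _)
    (fun s hs hseq => by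
      have hs' := Ico_subset_Icc_self hs
      have hgU : g (p s) ∈ U := h.mapsTo_inv (hpmem s hs')
      have h1 := hexp (g (p s)) hgU (hseq.trans_le hs'.2)
        (fderiv ℂ g (p s) ((κ * H' s) • e))
      have h2 := h.fderiv_fderiv_inv hf hgU ((κ * H' s) • e)
      have h3 : f (g (p s)) = p s := h.invOn.2 (hpmem s hs')
      rw [h3] at h2
      rw [h2, hseq, norm_smul, hen, mul_one, Real.norm_eq_abs,
        abs_of_pos (mul_pos hκ0 (hHpos s hs'))] at h1
      exact (le_of_mul_le_mul_left (h1.trans_eq (mul_comm _ _)) (hHpos s hs')).trans_lt hκ1)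
  have hdκ : d / κ ∈ Icc (H 0) (H ρ) := by
    rw [hH0, hHρ]
    refine ⟨by positivity, ?_⟩
    rw [div_le_iff₀ hκ0]
    rw [div_lt_iff₀ hr] at hκl
    linarith
  obtain ⟨s, hs, hsd⟩ := intermediate_value_Icc hρ hHc hdκ
  have hps : p s = f x := by
    simp only [hp, hsd, he]
    rw [mul_div_cancel₀ _ hκ0.ne', smul_smul, mul_inv_cancel₀ hd0.ne', one_smul]; abel
  have hgx : g (p s) = x := by rw [hps]; exact h.invOn.1 hx
  have hle : ‖g (p s)‖ ≤ s := hbound hs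
  rw [hgx] at hle
  exact hle.trans hs.2

end Schlicht

/-! ### The weight function and the root -/

section Weights

variable {n : ℕ} {α : ℝ}

theorem blochA0_pos (hα : 0 < α) : 0 < blochA0 n α := by unfold blochA0; positivity

theorem blochA0_sq (hα : 0 < α) : blochA0 n α ^ 2 * (α * ((n : ℝ) + 1) + 1) = 1 := by
  have h : 0 < α * (1 + (n : ℝ)) + 1 := by positivity
  rw [blochA0, div_pow, one_pow, Real.sq_sqrt h.le, add_comm (n : ℝ) 1, one_div,
    inv_mul_cancel₀ h.ne']

theorem blochA0_lt_one (hα : 0 < α) : blochA0 n α < 1 := by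
  have h1 := blochA0_sq (n := n) hα
  have h2 := blochA0_pos (n := n) hα
  have h3 : 0 < α * ((n : ℝ) + 1) := by positivity
  by_contra h
  push Not at h
  nlinarith [mul_pos (pow_pos h2 2) h3]

/-- `φ x = x (1 - x²) ^ (β / 2) / (a₀ κ)` with `β = α (n + 1)` and `κ = (1 - a₀²) ^ (β / 2)`. -/
theorem blochA0_mul_blochPhi (hα : 0 < α) (x : ℝ) :
    blochA0 n α * (1 - blochA0 n α ^ 2) ^ (α * ((n : ℝ) + 1) / 2) * blochPhi n α x =
      x * (1 - x ^ 2) ^ (α * ((n : ℝ) + 1) / 2) := by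
  have hβ : 0 < α * ((n : ℝ) + 1) := by positivity
  have h : 0 < α * (1 + (n : ℝ)) + 1 := by positivity
  have hs : blochA0 n α * Real.sqrt (α * (1 + (n : ℝ)) + 1) = 1 := by
    rw [blochA0, one_div, inv_mul_cancel₀ (Real.sqrt_ne_zero'.2 h)]
  have ha2 : 1 - blochA0 n α ^ 2 = ((α * ((n : ℝ) + 1) + 1) / (α * ((n : ℝ) + 1)))⁻¹ := by
    have h1 := blochA0_sq (n := n) hα
    rw [inv_div, eq_div_iff (by positivity)]
    linarith
  have hb : 0 < (α * ((n : ℝ) + 1) + 1) / (α * ((n : ℝ) + 1)) := by positivity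
  have hq : (1 - blochA0 n α ^ 2) ^ (α * ((n : ℝ) + 1) / 2) *
      ((α * ((n : ℝ) + 1) + 1) / (α * ((n : ℝ) + 1))) ^ (α * ((n : ℝ) + 1) / 2) = 1 := by
    rw [ha2, Real.inv_rpow hb.le, inv_mul_cancel₀ (Real.rpow_pos_of_pos hb _).ne']
  unfold blochPhi
  linear_combination (x * (1 - x ^ 2) ^ (α * ((n : ℝ) + 1) / 2) *
    (1 - blochA0 n α ^ 2) ^ (α * ((n : ℝ) + 1) / 2) *
      ((α * ((n : ℝ) + 1) + 1) / (α * ((n : ℝ) + 1))) ^ (α * ((n : ℝ) + 1) / 2)) * hs +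
    (x * (1 - x ^ 2) ^ (α * ((n : ℝ) + 1) / 2)) * hq

theorem blochA0_mul_rpow_pos (hα : 0 < α) :
    0 < blochA0 n α * (1 - blochA0 n α ^ 2) ^ (α * ((n : ℝ) + 1) / 2) := by
  have h0 := blochA0_pos (n := n) hα
  have h1 := blochA0_lt_one (n := n) hα
  exact mul_pos h0 (Real.rpow_pos_of_pos (by nlinarith) _)

theorem strictMonoOn_blochPhi (hα : 0 < α) :
    StrictMonoOn (blochPhi n α) (Icc 0 (blochA0 n α)) := by
  intro x hx y hy hxy
  have h : x * (1 - x ^ 2) ^ (α * ((n : ℝ) + 1) / 2) < y * (1 - y ^ 2) ^ (α * ((n : ℝ) + 1) / 2) :=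
    strictMonoOn_mul_one_sub_sq_rpow (blochA0_lt_one (n := n) hα) (blochA0_sq hα) hx hy hxy
  rw [← blochA0_mul_blochPhi hα x, ← blochA0_mul_blochPhi hα y] at h
  exact lt_of_mul_lt_mul_left h (blochA0_mul_rpow_pos hα).le

theorem blochPhi_zero : blochPhi n α 0 = 0 := by
  simp only [blochPhi, zero_mul]

theorem blochPhi_blochA0 (hα : 0 < α) : blochPhi n α (blochA0 n α) = 1 := by
  have h := blochA0_mul_blochPhi (n := n) hα (blochA0 n α)
  exact (mul_eq_left₀ (blochA0_mul_rpow_pos hα).ne').1 h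

theorem continuousOn_blochPhi (hα : 0 < α) :
    ContinuousOn (blochPhi n α) (Icc 0 (blochA0 n α)) := by
  have h : 0 ≤ α * ((n : ℝ) + 1) / 2 := by positivity
  have hc : Continuous fun x : ℝ => (1 - x ^ 2) ^ (α * ((n : ℝ) + 1) / 2) :=
    (by fun_prop : Continuous fun x : ℝ => 1 - x ^ 2).rpow_const fun _ => Or.inr h
  exact (((continuous_id.mul hc).mul_const _).mul_const _).continuousOn

theorem existsUnique_isBlochRoot (hα : 0 < α) {lam : ℝ} (hlam : lam ∈ Ioc (0 : ℝ) 1) :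
    ∃! m : ℝ, IsBlochRoot n α lam m := by
  have hmem : lam ∈ Icc (blochPhi n α 0) (blochPhi n α (blochA0 n α)) := by
    rw [blochPhi_zero, blochPhi_blochA0 hα]; exact ⟨hlam.1.le, hlam.2⟩
  obtain ⟨m, hm, hmlam⟩ := intermediate_value_Icc (blochA0_pos hα).le (continuousOn_blochPhi hα) hmem
  exact ⟨m, ⟨hm, hmlam⟩, fun m' hm' =>
    (strictMonoOn_blochPhi hα).injOn hm'.1 hm (hm'.2.trans hmlam.symm)⟩

theorem IsBlochRoot.pos {lam m : ℝ} (hlam : 0 < lam) (hm : IsBlochRoot n α lam m) : 0 < m := by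
  refine lt_of_le_of_ne hm.1.1 fun h => ?_
  have := hm.2
  rw [← h, blochPhi_zero] at this
  exact hlam.ne this

end Weights

/-! ### Bounds for the derivative of a Bloch mapping -/

section Bounds

variable {n : ℕ} {α : ℝ} {f : CSpace n → CSpace n}

/-- The pointwise form of `‖f‖_{0,α} ≤ 1`, raised to the power `n`. -/
theorem rpow_mul_norm_det_le_one (hn : 1 ≤ n) (hf0 : detSeminorm α f ≤ 1) {z : CSpace n}
    (hz : ‖z‖ < 1) :
    (1 - ‖z‖ ^ 2) ^ (α * ((n : ℝ) + 1) / 2) * ‖(fderiv ℂ f z).det‖ ≤ 1 := by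
  have hn0 : (n : ℝ) ≠ 0 := by positivity
  have hpos : 0 ≤ 1 - ‖z‖ ^ 2 := by nlinarith [norm_nonneg z]
  have h : ENNReal.ofReal ((1 - ‖z‖ ^ 2) ^ (α * ((n : ℝ) + 1) / (2 * (n : ℝ))) *
      ‖(fderiv ℂ f z).det‖ ^ (1 / (n : ℝ))) ≤ 1 :=
    (le_iSup₂_of_le z (mem_ball_zero_iff.2 hz) le_rfl).trans hf0
  rw [ENNReal.ofReal_le_one] at h
  have h2 := pow_le_one₀ (n := n) (by positivity) h
  rw [mul_pow, ← Real.rpow_mul_natCast hpos, ← Real.rpow_mul_natCast (norm_nonneg _),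
    one_div_mul_cancel hn0, Real.rpow_one] at h2
  have hexp : α * ((n : ℝ) + 1) / (2 * (n : ℝ)) * n = α * ((n : ℝ) + 1) / 2 := by field_simp
  rwa [hexp] at h2

/-- The pointwise form of `‖f‖_α ≤ K`. -/
theorem rpow_mul_norm_fderiv_le {K : ℝ} (hK : 0 ≤ K) (hfK : blochSeminorm α f ≤ ENNReal.ofReal K)
    {z : CSpace n} (hz : ‖z‖ < 1) : (1 - ‖z‖ ^ 2) ^ α * ‖fderiv ℂ f z‖ ≤ K := by
  have h : ENNReal.ofReal ((1 - ‖z‖ ^ 2) ^ α * ‖fderiv ℂ f z‖) ≤ ENNReal.ofReal K :=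
    (le_iSup₂_of_le z (mem_ball_zero_iff.2 hz) le_rfl).trans hfK
  exact (ENNReal.ofReal_le_ofReal_iff hK).1 h

/-- The sharp lower bound for the Jacobian, from the one-dimensional bound on the complex line
through `z`. -/
theorem le_norm_det_fderiv (hn : 1 ≤ n) (hα : 0 < α) (hf : HolomorphicOnBall f)
    (hf0 : detSeminorm α f ≤ 1) {lam m : ℝ} (hlam : 0 < lam)
    (hdet : (fderiv ℂ f 0).det = (lam : ℂ)) (hm : IsBlochRoot n α lam m)
    {z : CSpace n} (hz : ‖z‖ < m) :
    lam / m * (m - ‖z‖) / (1 - m * ‖z‖) ^ (α * ((n : ℝ) + 1) + 1) ≤ ‖(fderiv ℂ f z).det‖ := by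
  have : Nonempty (Fin n) := ⟨⟨0, hn⟩⟩
  have hm0 := hm.pos hlam
  have ha1 := blochA0_lt_one (n := n) hα
  have hm1 : m < 1 := hm.1.2.trans_lt ha1
  -- a unit vector spanning the line through `z`, also for `z = 0`
  obtain ⟨u, hu, hzu⟩ : ∃ u : CSpace n, ‖u‖ = 1 ∧ ((‖z‖ : ℝ) : ℂ) • u = z := by
    rcases eq_or_ne z 0 with rfl | hz0
    · obtain ⟨u, hu⟩ := NormedSpace.sphere_nonempty (E := CSpace n) (x := 0) (r := 1) |>.2 zero_le_one
      exact ⟨u, by simpa using hu, by simp⟩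
    · have hz' : ‖z‖ ≠ 0 := norm_ne_zero_iff.2 hz0
      refine ⟨((‖z‖⁻¹ : ℝ) : ℂ) • z, by simp [norm_smul, hz'], ?_⟩
      rw [smul_smul, ← Complex.ofReal_mul, mul_inv_cancel₀ hz', Complex.ofReal_one, one_smul]
  have hnorm : ∀ ζ : ℂ, ‖ζ • u‖ = ‖ζ‖ := fun ζ => by rw [norm_smul, hu, mul_one]
  have hgd : DifferentiableOn ℂ (fun ζ : ℂ => (fderiv ℂ f (ζ • u)).det) (ball 0 1) :=
    (differentiableOn_det_fderiv_line isOpen_ball hf u).mono fun ζ hζ => by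
      have h1 : ‖ζ • u‖ < 1 := by rw [hnorm]; exact mem_ball_zero_iff.1 hζ
      exact mem_ball_zero_iff.2 h1
  have hΦ := blochA0_mul_blochPhi (n := n) hα m
  rw [hm.2] at hΦ
  have h := distortion_of_le (by positivity : 0 < α * ((n : ℝ) + 1)) (blochA0_pos (n := n) hα) ha1
    (blochA0_sq hα) hgd (m := m)
    (fun ζ hζ => by
      have h1 : ‖ζ • u‖ < 1 := by rw [hnorm]; exact mem_ball_zero_iff.1 hζ
      have h2 := rpow_mul_norm_det_le_one hn hf0 h1
      rwa [hnorm] at h2)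
    hm0 hm.1.2
    (by
      rw [zero_smul, hdet, Complex.norm_real, Real.norm_eq_abs, abs_of_pos hlam, hΦ])
    (norm_nonneg z) hz
  rw [hzu] at h
  have hq := blochA0_mul_rpow_pos (n := n) hα
  have hmz : 0 < 1 - m * ‖z‖ := by nlinarith [norm_nonneg z]
  rw [div_le_iff₀ (Real.rpow_pos_of_pos hmz _)]
  refine le_of_mul_le_mul_left ?_ hq
  calc _ = (blochA0 n α * (1 - blochA0 n α ^ 2) ^ (α * ((n : ℝ) + 1) / 2) * lam) / m *
        (m - ‖z‖) := by ring
    _ = (1 - m ^ 2) ^ (α * ((n : ℝ) + 1) / 2) * (m - ‖z‖) := by rw [hΦ]; field_simp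
    _ ≤ _ := h.trans_eq (by ring)

/-- Lower bound for the expansion of lengths by `f`, combining the Jacobian bound with
`norm_det_mul_norm_le`. -/
theorem mul_norm_le_norm_fderiv_apply (hn : 1 ≤ n) (hα : 0 < α) (hf : HolomorphicOnBall f)
    {K : ℝ} (hK : 1 ≤ K) (hfK : blochSeminorm α f ≤ ENNReal.ofReal K)
    (hf0 : detSeminorm α f ≤ 1) {lam m : ℝ} (hlam : 0 < lam)
    (hdet : (fderiv ℂ f 0).det = (lam : ℂ)) (hm : IsBlochRoot n α lam m)
    {z : CSpace n} (hz : ‖z‖ < m) (v : CSpace n) :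
    lam * K ^ (1 - (n : ℤ)) / m * ((1 - ‖z‖ ^ 2) ^ (α * ((n : ℝ) - 1)) * (m - ‖z‖) /
      (1 - m * ‖z‖) ^ (α * ((n : ℝ) + 1) + 1)) * ‖v‖ ≤ ‖fderiv ℂ f z v‖ := by
  have hK0 : 0 < K := by linarith
  have hm1 : m < 1 := hm.1.2.trans_lt (blochA0_lt_one hα)
  have hz1 : ‖z‖ < 1 := hz.trans hm1
  have hpos : 0 < 1 - ‖z‖ ^ 2 := by nlinarith [norm_nonneg z]
  have hJ := le_norm_det_fderiv hn hα hf hf0 hlam hdet hm hz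
  have hA := norm_det_mul_norm_le hn (fderiv ℂ f z) v
  have hB := pow_le_pow_left₀ (by positivity) (rpow_mul_norm_fderiv_le hK0.le hfK hz1) (n - 1)
  have hexp : ((1 - ‖z‖ ^ 2) ^ α) ^ (n - 1) = (1 - ‖z‖ ^ 2) ^ (α * ((n : ℝ) - 1)) := by
    rw [← Real.rpow_mul_natCast hpos.le, Nat.cast_sub hn, Nat.cast_one]
  have hKe : K ^ (1 - (n : ℤ)) = (K ^ (n - 1))⁻¹ := by
    rw [← zpow_natCast, ← zpow_neg, Nat.cast_sub hn]; congr 1; push_cast; ring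
  rw [mul_pow, hexp] at hB
  set D := (1 - ‖z‖ ^ 2) ^ (α * ((n : ℝ) - 1)) with hD
  have hD0 : 0 < D := Real.rpow_pos_of_pos hpos _
  rw [hKe]
  have hKn : 0 < K ^ (n - 1) := by positivity
  calc _ = (K ^ (n - 1))⁻¹ * (D * (lam / m * (m - ‖z‖) /
        (1 - m * ‖z‖) ^ (α * ((n : ℝ) + 1) + 1) * ‖v‖)) := by ring
    _ ≤ (K ^ (n - 1))⁻¹ * (D * (‖fderiv ℂ f z‖ ^ (n - 1) * ‖fderiv ℂ f z v‖)) := by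
        refine mul_le_mul_of_nonneg_left (mul_le_mul_of_nonneg_left ?_ hD0.le) (by positivity)
        exact (mul_le_mul_of_nonneg_right hJ (norm_nonneg v)).trans hA
    _ = (K ^ (n - 1))⁻¹ * ((D * ‖fderiv ℂ f z‖ ^ (n - 1)) * ‖fderiv ℂ f z v‖) := by ring
    _ ≤ (K ^ (n - 1))⁻¹ * (K ^ (n - 1) * ‖fderiv ℂ f z v‖) := by gcongr
    _ = _ := by rw [inv_mul_cancel_left₀ hKn.ne']

end Bounds

/-! ### The radius of the largest schlicht ball -/

theorem theorem2 (n : ℕ) (hn : 1 ≤ n) (α : ℝ) (hα : 0 < α) (K : ℝ) (hK : 1 ≤ K)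
    (lam : ℝ) (hlam : lam ∈ Set.Ioc (0 : ℝ) 1)
    (f : CSpace n → CSpace n) (hf : MemBloch α f)
    (hfK : blochSeminorm α f ≤ ENNReal.ofReal K)
    (hf0 : detSeminorm α f = 1)
    (hdet : (fderiv ℂ f 0).det = (lam : ℂ)) :
    (∃! m : ℝ, IsBlochRoot n α lam m) ∧
    IsGreatest {r : ℝ | IsSchlichtBall f 0 r} (schlichtRadius 0 f) ∧
    ∀ m : ℝ, IsBlochRoot n α lam m →
      lam * K ^ (1 - (n : ℤ)) / m *
          (∫ t in (0 : ℝ)..m,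
            (1 - t ^ 2) ^ (α * ((n : ℝ) - 1)) * (m - t) /
              (1 - m * t) ^ (α * ((n : ℝ) + 1) + 1))
        ≤ schlichtRadius 0 f := by
  have hexu := existsUnique_isBlochRoot (n := n) hα hlam
  obtain ⟨hhol, -⟩ := hf
  have hJpos : ∀ m : ℝ, IsBlochRoot n α lam m →
      ∀ x ∈ ball (0 : CSpace n) m, (fderiv ℂ f x).det ≠ 0 := by
    intro m hm x hx
    have hx' : ‖x‖ < m := mem_ball_zero_iff.1 hx
    have hm0 := hm.pos hlam.1
    have hm1 : m < 1 := hm.1.2.trans_lt (blochA0_lt_one hα)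
    have h := le_norm_det_fderiv hn hα hhol hf0.le hlam.1 hdet hm hx'
    have hmx : 0 < 1 - m * ‖x‖ := by nlinarith [norm_nonneg x]
    refine norm_pos_iff.1 (lt_of_lt_of_le ?_ h)
    exact div_pos (mul_pos (div_pos hlam.1 hm0) (by linarith)) (Real.rpow_pos_of_pos hmx _)
  have hgreat : IsGreatest {r : ℝ | IsSchlichtBall f 0 r} (schlichtRadius 0 f) := by
    obtain ⟨m, hm, -⟩ := hexu
    exact isGreatest_schlichtRadius hn hhol (exists_isSchlichtBall hhol (hm.pos hlam.1)
      (hm.1.2.trans (blochA0_lt_one hα).le) (hJpos m hm))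
  refine ⟨hexu, hgreat, fun m hm => ?_⟩
  have hm0 := hm.pos hlam.1
  have hm1 : m < 1 := hm.1.2.trans_lt (blochA0_lt_one hα)
  set c := lam * K ^ (1 - (n : ℤ)) / m with hc
  have hc0 : 0 < c := by have := hlam.1; positivity
  set h : ℝ → ℝ := fun t => (1 - t ^ 2) ^ (α * ((n : ℝ) - 1)) * (m - t) /
    (1 - m * t) ^ (α * ((n : ℝ) + 1) + 1) with hh
  have hhc : ContinuousOn h (Ioo (-1) 1) := by
    have h1 : ∀ t ∈ Ioo (-1 : ℝ) 1, 1 - t ^ 2 ≠ 0 := fun t ht => by nlinarith [ht.1, ht.2]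
    have h2 : ∀ t ∈ Ioo (-1 : ℝ) 1, 0 < 1 - m * t := fun t ht => by nlinarith [ht.1, ht.2]
    refine ContinuousOn.div (ContinuousOn.mul ?_ (by fun_prop)) ?_ fun t ht =>
      (Real.rpow_pos_of_pos (h2 t ht) _).ne'
    · exact ContinuousOn.rpow_const (by fun_prop) fun t ht => Or.inl (h1 t ht)
    · exact ContinuousOn.rpow_const (by fun_prop) fun t ht => Or.inl (h2 t ht).ne'
  have hhpos : ∀ t, 0 ≤ t → t < m → 0 < c * h t := fun t ht0 htm => by
    have h1 : 0 < 1 - t ^ 2 := by nlinarith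
    have h2 : 0 < 1 - m * t := by nlinarith
    exact mul_pos hc0 (div_pos (mul_pos (Real.rpow_pos_of_pos h1 _) (by linarith))
      (Real.rpow_pos_of_pos h2 _))
  set H : ℝ → ℝ := fun s => c * ∫ t in (0 : ℝ)..s, h t with hH
  have hHd : ∀ s ∈ Icc 0 m, HasDerivAt H (c * h s) s := by
    intro s hs
    have hs1 : s ∈ Ioo (-1 : ℝ) 1 := ⟨by linarith [hs.1], by linarith [hs.2]⟩
    refine HasDerivAt.const_mul c (intervalIntegral.integral_hasDerivAt_right ?_ ?_ ?_)
    · refine ContinuousOn.intervalIntegrable (hhc.mono ?_)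
      rw [uIcc_of_le hs.1]
      exact fun t ht => ⟨by linarith [ht.1], ht.2.trans_lt hs1.2⟩
    · exact hhc.stronglyMeasurableAtFilter isOpen_Ioo s hs1
    · exact hhc.continuousAt (isOpen_Ioo.mem_nhds hs1)
  have hHc : ContinuousOn H (Icc 0 m) := fun s hs => (hHd s hs).continuousAt.continuousWithinAt
  have hH0 : H 0 = 0 := by simp [hH]
  change H m ≤ schlichtRadius 0 f
  by_contra hlt
  push Not at hlt
  obtain ⟨U, hU⟩ := IsSchlichtBall.exists_domain hgreat.1
  obtain ⟨ρ, hρ, hHρ⟩ := intermediate_value_Icc hm0.le hHc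
    (show schlichtRadius 0 f ∈ Icc (H 0) (H m) from ⟨by rw [hH0]; exact hU.radius_pos.le, hlt.le⟩)
  have hρm : ρ < m := lt_of_le_of_ne hρ.2 fun he => by rw [he] at hHρ; exact hlt.ne' hHρ
  have hexp : ∀ x : CSpace n, ‖x‖ < m → ∀ v, c * h ‖x‖ * ‖v‖ ≤ ‖fderiv ℂ f x v‖ :=
    fun x hx v => mul_norm_le_norm_fderiv_apply hn hα hhol hK hfK hf0.le hlam.1 hdet hm hx v
  have hUρ : U ⊆ closedBall 0 ρ := hU.subset_closedBall hhol (H' := fun t => c * h t) hρ.1 hH0 hHρ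
    (fun s hs => hHd s ⟨hs.1, hs.2.trans hρ.2⟩)
    (fun s hs => hhpos s hs.1 (hs.2.trans_lt hρm))
    (fun x _ hxρ v => hexp x (hxρ.trans_lt hρm) v)
  -- on the compact interval `[0, ρ]` the expansion factor has a positive minimum
  obtain ⟨s, hs, hsmin⟩ := isCompact_Icc.exists_isMinOn (nonempty_Icc.2 hρ.1)
    (hhc.const_mul c |>.mono fun t (ht : t ∈ Icc 0 ρ) =>
      (⟨by linarith [ht.1], by linarith [ht.2]⟩ : t ∈ Ioo (-1 : ℝ) 1))
  obtain ⟨r', hr', hball⟩ := hU.exists_radius_gt hhol hm1.le (hJpos m hm) hρm hUρ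
    (hhpos s hs.1 (hs.2.trans_lt hρm)) fun x hx v => by
      have hxρ : ‖x‖ ≤ ρ := mem_closedBall_zero_iff.1 (hUρ hx)
      have hle : c * h s ≤ c * h ‖x‖ := hsmin ⟨norm_nonneg x, hxρ⟩
      exact (mul_le_mul_of_nonneg_right hle (norm_nonneg v)).trans (hexp x (hxρ.trans_lt hρm) v)
  exact (hgreat.2 hball).not_gt hr'
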